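/- Let $\Gamma$ be the set of edges of the (infinite, planar) hexagonal lattice, let $\mathcal A$ be the quasi-local C*-algebra of the spin system with $\mathcal A_x \simeq \mathrm{End}(\mathbb C^2)$ at every $x \in \Gamma$ (the norm completion of the union of the algebras $\mathcal A_X = \bigotimes_{x\in X}\mathcal A_x$, $X \subset \Gamma$ finite), and let $\sigma_x^X,\sigma_x^Z\in\mathcal A_x$ be the Pauli matrices. Let $\omega_0$ be the pure product state with $\omega_0(\sigma^Z_x)=1$ for all $x\in\Gamma$, with GNS triple $(\pi_0,\mathcal H_0,\Omega_0)$. For a hexagon $p$ put $A_p=\prod_{x\in p}\sigma^X_x$, the product over the six edges of $p$, and for a finite set $\Pi$ of hexagons put $A_\Pi=\prod_{p\in\Pi}A_p$. Let $\partial\Pi$ be the set of edges that belong to exactly one hexagon of $\Pi$ (a disjoint union of closed loops), and let $\sharp\Pi$ be the number of connected components (closed loops) of $\partial\Pi$. For a finite set $\Lambda$ of hexagons let $$\Omega_\Lambda = 2^{-|\Lambda|/2}\sum_{\Pi\subset\Lambda}(-1)^{\sharp\Pi}\,\pi_0(A_\Pi)\,\Omega_0 ,\qquad \omega_\Lambda(a)=\langle\Omega_\Lambda,\pi_0(a)\Omega_\Lambda\rangle\quad(a\in\mathcal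 A).$$ Theorem. There is a pure state $\omega$ on $\mathcal A$ such that for every increasing sequence $\Pi_1\subset\Pi_2\subset\cdots$ of finite sets of hexagons whose union is the set of all hexagons, the functionals $\omega_n=\omega_{\Pi_n}$ converge to $\omega$ in the weak-* topology. (This $\omega$ is the infinite-volume double semion state.) -/

import Mathlib

open Filter Topology
open scoped ComplexOrder ENNReal symmDiff

noncomputable section

namespace DoubleSemion

/-! ### The hexagonal lattice

Let `e₁, e₂` be the generators of a triangular lattice in the plane, at an angle of 60 degrees.
For `R = (a, b)`, the black vertex `R` of the hexagonal lattice sits at `a e₁ + b e₂`, and the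
white vertex `R` sits at `a e₁ + b e₂ + (e₁ + e₂) / 3`.  Every vertex has three neighbours. -/

/-- Vertices of the hexagonal lattice. -/
inductive Vertex where
  | black (R : ℤ × ℤ)
  | white (R : ℤ × ℤ)

/-- Edges of the hexagonal lattice (the sites of the spin system).  The edge `(R, i)` contains the
black vertex `R`, and `i` says in which of the three directions it leaves that vertex. -/
abbrev Edge : Type := (ℤ × ℤ) × Fin 3

/-- The end of an edge at its black vertex. -/
def Edge.blackEnd (x : Edge) : Vertex := .black x.1

/-- The end of an edge at its white vertex: the black vertex `R` is adjacent to the white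
vertices `R`, `R - e₁` and `R - e₂`. -/
def Edge.whiteEnd (x : Edge) : Vertex :=
  .white (x.1 - (![((0 : ℤ), (0 : ℤ)), (1, 0), (0, 1)] x.2))

/-- Two distinct edges are adjacent if they have a common end. -/
def edgeGraph : SimpleGraph Edge where
  Adj x y := x ≠ y ∧ (x.blackEnd = y.blackEnd ∨ x.whiteEnd = y.whiteEnd)
  symm := ⟨fun _ _ h => ⟨h.1.symm, h.2.imp Eq.symm Eq.symm⟩⟩
  loopless := ⟨fun _ h => h.1 rfl⟩

/-- Hexagons (faces) of the lattice.  The hexagon `R` has centre `R + (2 e₁ - e₂) / 3`. -/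
abbrev Hexagon : Type := ℤ × ℤ

/-- The six edges of a hexagon, in cyclic order.  Its vertices are, in this order, white `R - e₂`,
black `R`, white `R`, black `R + e₁`, white `R + e₁ - e₂`, black `R + e₁ - e₂`. -/
def Hexagon.edges (R : Hexagon) : Finset Edge :=
  {(R, 2), (R, 0), (R + (1, 0), 1), (R + (1, 0), 2), (R + (1, -1), 0), (R + (1, -1), 1)}

/-- The string configuration `∂Π` around a finite set `Π` of hexagons: the edges that belong to
exactly one hexagon of `Π`. -/
def boundary (P : Finset Hexagon) : Finset Edge :=
  (P.biUnion Hexagon.edges).filter fun x => (P.filter fun p => x ∈ p.edges).card = 1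

/-- The number `♯Π` of connected components (closed loops) of the string configuration `∂Π`. -/
def loopCount (P : Finset Hexagon) : ℕ :=
  Nat.card (edgeGraph.induce (boundary P : Set Edge)).ConnectedComponent

/-! ### The quasi-local algebra

A spin configuration that differs from "all up" at finitely many edges is given by the finite set
of its down edges.  Let `ℋ₀` be the Hilbert space with these configurations as orthonormal basis.
The local observables (finite tensor products of `2 × 2` matrices) act faithfully on `ℋ₀`; together
with the vector `Ω₀` of the configuration "all up" this is the GNS representation of the pure
product state `ω₀` with `ω₀(σᶻ) = 1` at every edge.  The quasi-local algebra is the norm closure of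
the local observables. -/

/-- The Hilbert space `ℋ₀` of square-summable functions on the finite sets of down edges. -/
abbrev HilbertSpace : Type := lp (fun _ : Finset Edge => ℂ) 2

/-- The operator `(T f)(α) = c(α) f(e α)`, for a permutation `e` of the basis configurations and
a function `c` with values of modulus one. -/
def monomialOp (e : Equiv.Perm (Finset Edge)) (c : Finset Edge → ℂ) (hc : ∀ α, ‖c α‖ = 1) :
    HilbertSpace →L[ℂ] HilbertSpace :=
  LinearIsometry.toContinuousLinearMap
    { toFun := fun f => ⟨fun α => c α * f (e α), by
        have hf := (memℓp_gen_iff (by norm_num)).1 f.2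
        refine (memℓp_gen_iff (by norm_num)).2 ?_
        simpa [hc, Function.comp_def] using (e.summable_iff.2 hf)⟩
      map_add' := fun f g => by
        ext α
        exact mul_add _ _ _
      map_smul' := fun a f => by
        ext α
        exact mul_left_comm _ _ _
      norm_map' := fun f => by
        rw [lp.norm_eq_tsum_rpow (by norm_num), lp.norm_eq_tsum_rpow (by norm_num)]
        congr 1
        rw [← e.tsum_eq fun α => ‖f α‖ ^ (2 : ℝ≥0∞).toReal]
        refine tsum_congr fun α => ?_
        change ‖c α * f (e α)‖ ^ _ = _
        rw [norm_mul, hc, one_mul] }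

theorem monomialOp_apply (e : Equiv.Perm (Finset Edge)) (c : Finset Edge → ℂ)
    (hc : ∀ α, ‖c α‖ = 1) (f : HilbertSpace) (α : Finset Edge) :
    monomialOp e c hc f α = c α * f (e α) := rfl

/-- The Pauli matrix `σˣ` at the edge `x`: it flips the spin at `x`. -/
def sigmaX (x : Edge) : HilbertSpace →L[ℂ] HilbertSpace :=
  monomialOp (Function.Involutive.toPerm (fun α => α ∆ {x}) fun α =>
    symmDiff_symmDiff_cancel_right {x} α) (fun _ => 1) fun _ => norm_one

/-- The Pauli matrix `σᶻ` at the edge `x`: it is `-1` on down spins and `1` on up spins. -/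
def sigmaZ (x : Edge) : HilbertSpace →L[ℂ] HilbertSpace :=
  monomialOp (Equiv.refl _) (fun α => if x ∈ α then -1 else 1) fun α => by split_ifs <;> simp

/-- The *-algebra of local observables supported in a set `X` of edges, generated by the Pauli
matrices at the edges of `X`. -/
def localAlgebra (X : Set Edge) : StarSubalgebra ℂ (HilbertSpace →L[ℂ] HilbertSpace) :=
  StarAlgebra.adjoin ℂ (sigmaX '' X ∪ sigmaZ '' X)

/-- The C*-algebra of quasi-local observables. -/
def quasiLocalAlgebra : StarSubalgebra ℂ (HilbertSpace →L[ℂ] HilbertSpace) :=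
  (localAlgebra Set.univ).topologicalClosure

/-! ### States -/

/-- The state space of a unital C*-algebra, with the weak-* topology: the positive normalized
functionals. -/
def stateSpace (A : Type*) [CStarAlgebra A] : Set (WeakDual ℂ A) :=
  {φ | (∀ a : A, 0 ≤ φ (star a * a)) ∧ φ 1 = 1}

/-- Pure states: the extreme points of the state space. -/
def pureStates (A : Type*) [CStarAlgebra A] : Set (WeakDual ℂ A) :=
  Set.extremePoints ℝ (stateSpace A)

instance : CStarAlgebra quasiLocalAlgebra :=
  have : IsClosed (quasiLocalAlgebra : Set (HilbertSpace →L[ℂ] HilbertSpace)) :=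
    StarSubalgebra.isClosed_topologicalClosure _
  StarSubalgebra.cstarAlgebra quasiLocalAlgebra

/-- The functional `a ↦ ⟨Ψ, a Ψ⟩` on the quasi-local algebra. -/
def vectorFunctional (Ψ : HilbertSpace) : WeakDual ℂ quasiLocalAlgebra :=
  StrongDual.toWeakDual
    { toFun := fun a => inner ℂ Ψ ((a : HilbertSpace →L[ℂ] HilbertSpace) Ψ)
      map_add' := fun a b => by simp
      map_smul' := fun z a => by simp
      cont := by fun_prop }

/-! ### The double semion vectors -/

theorem sigmaX_commute (x y : Edge) : Commute (sigmaX x) (sigmaX y) := by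
  ext f α
  change (1 : ℂ) * (1 * f ((α ∆ {x}) ∆ {y})) = 1 * (1 * f ((α ∆ {y}) ∆ {x}))
  rw [symmDiff_right_comm]

/-- The operator `A_p`, the product of `σˣ` over the six edges of the hexagon `p`. -/
def hexagonOp (p : Hexagon) : HilbertSpace →L[ℂ] HilbertSpace :=
  p.edges.noncommProd sigmaX fun x _ y _ _ => sigmaX_commute x y

theorem hexagonOp_commute (p q : Hexagon) : Commute (hexagonOp p) (hexagonOp q) :=
  Finset.noncommProd_commute _ _ _ _ fun _ _ =>
    (Finset.noncommProd_commute _ _ _ _ fun _ _ => sigmaX_commute _ _).symm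

/-- The operator `A_Π`, the product of `A_p` over the hexagons `p` of the finite set `Π`. -/
def regionOp (P : Finset Hexagon) : HilbertSpace →L[ℂ] HilbertSpace :=
  P.noncommProd hexagonOp fun p _ q _ _ => hexagonOp_commute p q

/-- The vector `Ω₀` of the configuration without strings. -/
def vacuum : HilbertSpace := lp.single 2 (∅ : Finset Edge) (1 : ℂ)

/-- For a finite set `Λ` of hexagons, the vector
`2 ^ (-|Λ| / 2) ∑_{Π ⊆ Λ} (-1) ^ ♯Π A_Π Ω₀`. -/
def semionVector (L : Finset Hexagon) : HilbertSpace :=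
  ((√(1 / 2 ^ L.card) : ℝ) : ℂ) • ∑ P ∈ L.powerset, (-1 : ℂ) ^ loopCount P • regionOp P vacuum

/-- The vector state of the double semion vector of `Λ`. -/
def semionState (L : Finset Hexagon) : WeakDual ℂ quasiLocalAlgebra :=
  vectorFunctional (semionVector L)

end DoubleSemion

end

/-!
The limit state is the unique frustration-free ground state of the double semion model. Two kinds
of local isometries fix the double semion vectors: for every vertex the product of `σᶻ` over its
three edges, because `∂Π` is closed, and for every hexagon `p` of the region a plaquette operator,
the product of `A_p` and a diagonal operator that depends on the six legs of `p` only. A state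
with all these stabilizers is unique (`groundStates_subsingleton`), and this is enough. By the
theorem of Banach and Alaoglu the finite-volume states have cluster points, these are ground
states, so there is exactly one, and it is the limit. The ground states form a face of the state
space, since they are defined by the vanishing of expectations of positive elements; so the limit
is pure.

The plaquette operators exist because the sign `(-1) ^ ♯Π` changes by a local rule when a hexagon
is added: `neg_one_pow_loopCount_symmDiff_singleton`.  This rests on the fact that `♯Π` has the
parity of the Euler characteristic of the interior of `Π` (`neg_one_pow_loopCount`).  No Jordan
curve theorem is needed.  Consider pairs of a hexagon of `Π` and one of its edges, and the product
of two permutations of them: reverse the pair if its edge has hexagons of `Π` on both sides, then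
move on by one edge around the hexagon.  The cycles of this product are the loops of `∂Π` and one
cycle of length three for each vertex interior to `Π`.  Its sign is computed once from the two
factors, once from the number of cycles.

For the uniqueness, local observables are spanned by the products `X_S Z_T` of Pauli matrices, over
finite sets `S`, `T` of edges.  If `S` is not closed, or if `S` is empty and `T` meets some hexagon
an odd number of times, the product anticommutes with a stabilizer and has expectation zero.  If `S`
is closed, it is a boundary `∂Q` (`exists_eq_boundary`), and the hexagons of `Q` can be removed one
at a time with plaquette operators, which leaves diagonal operators.  If `T` meets every hexagon an
even number of times, then `Z_T` is a product of vertex operators (`star_induction`) and has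
expectation one.  Both homological facts follow from the exactness of compactly supported closed
one-cochains on the square lattice, `exists_primitive`.
-/

noncomputable section

namespace DoubleSemion

/-! ### The sign of a permutation and the number of its cycles -/

/-- If the fibres of `c` are exactly the cycles (fixed points included) of the permutation `f`, then
the sign of `f` is determined by the number of points and the number of fibres. -/
theorem sign_eq_of_fibers_eq_cycles {α β : Type*} [Fintype α] [DecidableEq α] [Fintype β]
    (f : Equiv.Perm α) (c : α → β) (hc : Function.Surjective c)
    (h : ∀ x y, c x = c y ↔ f.SameCycle x y) :
    Equiv.Perm.sign f = (-1) ^ (Fintype.card α + Fintype.card β) := by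
  classical
  have hβ : Fintype.card β = f.cycleFactorsFinset.card + (f.supportᶜ).card := by
    have h1 : (Finset.univ : Finset β) = f.support.image c ∪ (f.supportᶜ).image c := by
      rw [← Finset.image_union, Finset.union_compl, Finset.image_univ_of_surjective hc]
    have h2 : Disjoint (f.support.image c) ((f.supportᶜ).image c) := by
      rw [Finset.disjoint_left]
      intro b hb hb'
      obtain ⟨x, hx, rfl⟩ := Finset.mem_image.1 hb
      obtain ⟨y, hy, hxy⟩ := Finset.mem_image.1 hb'
      have hs := (h _ _).1 hxy
      rw [Finset.mem_compl, Equiv.Perm.mem_support, not_not] at hy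
      have := hs.eq_of_left hy
      subst this
      exact (Equiv.Perm.mem_support.1 hx) hy
    have h3 : (f.support.image c).card = f.cycleFactorsFinset.card := by
      have h4 : f.cycleFactorsFinset = f.support.image f.cycleOf := by
        ext g
        constructor
        · intro hg
          obtain ⟨x, hx⟩ := (Equiv.Perm.mem_cycleFactorsFinset_iff.1 hg).1.nonempty_support
          exact Finset.mem_image.2 ⟨x, Equiv.Perm.mem_cycleFactorsFinset_support_le hg hx,
            (Equiv.Perm.cycle_is_cycleOf hx hg).symm⟩
        · intro hg
          obtain ⟨x, hx, rfl⟩ := Finset.mem_image.1 hg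
          exact Equiv.Perm.cycleOf_mem_cycleFactorsFinset_iff.2 hx
      -- A cycle is recovered from its fibre as the cycle through any point of the fibre.
      have h5 : ∀ x, f.cycleOf (Function.surjInv hc (c x)) = f.cycleOf x := fun x =>
        ((h _ _).1 (Function.surjInv_eq hc (c x))).cycleOf_eq
      have h6 : f.support.image f.cycleOf =
          (f.support.image c).image fun b => f.cycleOf (Function.surjInv hc b) := by
        rw [Finset.image_image]
        exact Finset.image_congr fun x _ => (h5 x).symm
      rw [h4, h6]
      refine (Finset.card_image_of_injOn ?_).symm
      intro b hb b' hb' hbb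
      obtain ⟨x, hx, rfl⟩ := Finset.mem_image.1 hb
      obtain ⟨y, hy, rfl⟩ := Finset.mem_image.1 hb'
      simp only [h5] at hbb
      exact (h _ _).2 ((Equiv.Perm.sameCycle_iff_cycleOf_eq_of_mem_support hx hy).2 hbb)
    have h5 : ((f.supportᶜ).image c).card = (f.supportᶜ).card := by
      refine Finset.card_image_of_injOn fun x hx y _ hxy => ?_
      rw [Finset.mem_coe, Finset.mem_compl, Equiv.Perm.mem_support, not_not] at hx
      exact ((h _ _).1 hxy).eq_of_left hx
    rw [← Finset.card_univ, h1, Finset.card_union_of_disjoint h2, h3, h5]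
  have hα : Fintype.card α = f.support.card + (f.supportᶜ).card :=
    (Finset.card_add_card_compl _).symm
  have hct : Multiset.card f.cycleType = f.cycleFactorsFinset.card := by
    rw [Equiv.Perm.cycleType_def, Multiset.card_map]; rfl
  rw [Equiv.Perm.sign_of_cycleType, Equiv.Perm.sum_cycleType, hct, hα, hβ,
    show f.support.card + (f.supportᶜ).card + (f.cycleFactorsFinset.card + (f.supportᶜ).card)
      = f.support.card + f.cycleFactorsFinset.card + 2 * (f.supportᶜ).card by ring,
    pow_add _ _ (2 * _), pow_mul]
  simp

/-! ### Hexagons, their edges and their vertices -/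

/-- The hexagon on the other side of the `k`-th edge of the hexagon `p` is `p + dir k`. -/
def dir : Fin 6 → ℤ × ℤ := ![(-1, 0), (-1, 1), (0, 1), (1, 0), (1, -1), (0, -1)]

/-- The `k`-th edge of the hexagon `p`, in the cyclic order of `Hexagon.edges`. -/
def dartEdge (p : Hexagon) : Fin 6 → Edge :=
  ![(p, 2), (p, 0), (p + (1, 0), 1), (p + (1, 0), 2), (p + (1, -1), 0), (p + (1, -1), 1)]

/-- The `k`-th vertex of the hexagon `p`: the `k`-th edge runs from vertex `k` to
vertex `k + 1`. -/
def corner (p : Hexagon) : Fin 6 → Vertex :=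
  ![.white (p - (0, 1)), .black p, .white p, .black (p + (1, 0)), .white (p + (1, -1)),
    .black (p + (1, -1))]

theorem edges_eq_image (p : Hexagon) : p.edges = Finset.univ.image (dartEdge p) := by
  ext x
  simp [Hexagon.edges, dartEdge, Fin.exists_fin_succ, eq_comm]

theorem dartEdge_mem_edges (p : Hexagon) (k : Fin 6) : dartEdge p k ∈ p.edges := by
  rw [edges_eq_image]
  exact Finset.mem_image_of_mem _ (Finset.mem_univ k)

theorem add_dir_add_dir_add_three (p : Hexagon) (k : Fin 6) : p + dir k + dir (k + 3) = p := by
  obtain ⟨a, b⟩ := p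
  fin_cases k <;> simp [dir]

theorem add_dir_ne_self (p : Hexagon) (k : Fin 6) : p + dir k ≠ p := by
  obtain ⟨a, b⟩ := p
  fin_cases k <;> simp [dir, Prod.ext_iff]

theorem dartEdge_opposite (p : Hexagon) (k : Fin 6) :
    dartEdge (p + dir k) (k + 3) = dartEdge p k := by
  obtain ⟨a, b⟩ := p
  fin_cases k <;> simp [dir, dartEdge]

theorem dartEdge_eq_iff (p q : Hexagon) (k l : Fin 6) :
    dartEdge p k = dartEdge q l ↔ (q = p ∧ l = k) ∨ (q = p + dir k ∧ l = k + 3) := by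
  constructor
  · obtain ⟨a, b⟩ := p
    obtain ⟨c, d⟩ := q
    fin_cases k <;> fin_cases l <;> simp [dir, dartEdge, Prod.ext_iff] <;> omega
  · rintro (⟨rfl, rfl⟩ | ⟨rfl, rfl⟩)
    · rfl
    · exact (dartEdge_opposite p k).symm

theorem corner_eq_iff (p q : Hexagon) (k l : Fin 6) :
    corner p k = corner q l ↔ (q = p ∧ l = k) ∨ (q = p + dir k ∧ l = k + 4) ∨
      (q = p + dir (k + 5) ∧ l = k + 2) := by
  obtain ⟨a, b⟩ := p
  obtain ⟨c, d⟩ := q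
  fin_cases k <;> fin_cases l <;> simp [dir, corner, Prod.ext_iff] <;> omega

theorem ends_dartEdge (p : Hexagon) (k : Fin 6) :
    (dartEdge p k).blackEnd = corner p k ∧ (dartEdge p k).whiteEnd = corner p (k + 1) ∨
      (dartEdge p k).blackEnd = corner p (k + 1) ∧ (dartEdge p k).whiteEnd = corner p k := by
  obtain ⟨a, b⟩ := p
  fin_cases k <;> simp [corner, dartEdge, Edge.blackEnd, Edge.whiteEnd, sub_eq_add_neg]

theorem exists_dartEdge_eq (x : Edge) : ∃ p k, dartEdge p k = x := by
  obtain ⟨R, i⟩ := x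
  fin_cases i
  · exact ⟨R, 1, rfl⟩
  · exact ⟨R - (1, 0), 2, by simp [dartEdge]⟩
  · exact ⟨R, 0, rfl⟩

theorem dartEdge_mem_edges_iff (p q : Hexagon) (k : Fin 6) :
    dartEdge p k ∈ q.edges ↔ q = p ∨ q = p + dir k := by
  rw [edges_eq_image]
  simp only [Finset.mem_image, Finset.mem_univ, true_and]
  constructor
  · rintro ⟨l, hl⟩
    rcases (dartEdge_eq_iff _ _ _ _).1 hl.symm with h | h
    · exact Or.inl h.1
    · exact Or.inr h.1
  · rintro (rfl | rfl)
    · exact ⟨k, rfl⟩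
    · exact ⟨k + 3, dartEdge_opposite p k⟩

/-- The edge of a dart lies in `∂P` if exactly one of the hexagons on its two sides is in `P`. -/
theorem dartEdge_mem_boundary (P : Finset Hexagon) (p : Hexagon) (k : Fin 6) :
    dartEdge p k ∈ boundary P ↔ ¬(p ∈ P ↔ p + dir k ∈ P) := by
  have hne := add_dir_ne_self p k
  have h : (P.filter fun q => dartEdge p k ∈ q.edges) =
      (if p ∈ P then {p} else ∅) ∪ (if p + dir k ∈ P then {p + dir k} else ∅) := by
    ext q
    simp only [Finset.mem_filter, dartEdge_mem_edges_iff, Finset.mem_union]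
    split_ifs <;> simp <;> grind
  rw [boundary, Finset.mem_filter, h, Finset.mem_biUnion]
  by_cases h1 : p ∈ P <;> by_cases h2 : p + dir k ∈ P
  · simp [h1, h2, hne.symm]
  · have : ∃ q ∈ P, dartEdge p k ∈ q.edges := ⟨p, h1, dartEdge_mem_edges p k⟩
    simp only [this, h1, h2]; simp
  · have : ∃ q ∈ P, dartEdge p k ∈ q.edges :=
      ⟨_, h2, (dartEdge_mem_edges_iff _ _ _).2 (Or.inr rfl)⟩
    simp only [this, h1, h2]; simp
  · simp [h1, h2]

theorem boundary_empty : boundary ∅ = ∅ := by simp [boundary]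

theorem boundary_insert {P : Finset Hexagon} {p : Hexagon} (hp : p ∉ P) :
    boundary (insert p P) = boundary P ∆ p.edges := by
  ext x
  obtain ⟨q, k, rfl⟩ := exists_dartEdge_eq x
  have := add_dir_ne_self q k
  rw [Finset.mem_symmDiff, dartEdge_mem_boundary, dartEdge_mem_boundary, dartEdge_mem_edges_iff]
  simp only [Finset.mem_insert]
  grind

/-! ### The permutation that follows the boundary of a region -/

theorem add_dir_add_dir_add_four (p : Hexagon) (k : Fin 6) :
    p + dir k + dir (k + 4) = p + dir (k + 5) := by
  obtain ⟨a, b⟩ := p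
  fin_cases k <;> simp [dir]

theorem add_dir_add_five_add_dir (p : Hexagon) (k : Fin 6) :
    p + dir (k + 5) + dir (k + 2) = p := by
  have := add_dir_add_dir_add_three p (k + 5)
  rwa [show k + 5 + 3 = k + 2 from add_assoc k 5 3] at this

/-- A pair `(p, k)` with `p ∈ P` is a dart: the `k`-th edge of `p`, oriented so that `p` lies on a
fixed side.  `turn P` reverses the darts whose edge has hexagons of `P` on both sides. -/
def turn (P : Finset Hexagon) : Equiv.Perm (P × Fin 6) :=
  Function.Involutive.toPerm
    (fun x => if h : x.1.1 + dir x.2 ∈ P then (⟨x.1.1 + dir x.2, h⟩, x.2 + 3) else x) <| by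
    rintro ⟨⟨p, hp⟩, k⟩
    by_cases h : p + dir k ∈ P
    · simp only [h, dite_true, add_dir_add_dir_add_three, hp]
      rw [show k + 3 + 3 = k from (add_assoc k 3 3).trans (add_zero k)]
    · simp [h]

/-- The permutation that moves every dart to the next one around its hexagon. -/
def rot (P : Finset Hexagon) : Equiv.Perm (P × Fin 6) :=
  Equiv.prodCongrRight fun _ => Equiv.addRight 1

/-- The permutation that follows the boundary of `P`.  Its cycles are the loops of `∂P` and, for
each vertex whose three hexagons lie in `P`, a cycle of length three around this vertex. -/
def step (P : Finset Hexagon) : Equiv.Perm (P × Fin 6) := rot P * turn P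

section

variable {P : Finset Hexagon}

theorem step_of_mem {p : Hexagon} (hp : p ∈ P) {k : Fin 6} (h : p + dir k ∈ P) :
    step P (⟨p, hp⟩, k) = (⟨p + dir k, h⟩, k + 4) := by
  have : turn P (⟨p, hp⟩, k) = (⟨p + dir k, h⟩, k + 3) := dif_pos h
  rw [step, Equiv.Perm.mul_apply, this]
  change (_, k + 3 + 1) = _
  rw [add_assoc]; rfl

theorem step_of_notMem {p : Hexagon} (hp : p ∈ P) {k : Fin 6} (h : p + dir k ∉ P) :
    step P (⟨p, hp⟩, k) = (⟨p, hp⟩, k + 1) := by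
  have : turn P (⟨p, hp⟩, k) = (⟨p, hp⟩, k) := dif_neg h
  rw [step, Equiv.Perm.mul_apply, this]
  rfl

/-- The three hexagons around the initial vertex of the dart lie in `P`. -/
def IsInner (P : Finset Hexagon) (x : P × Fin 6) : Prop :=
  x.1.1 + dir x.2 ∈ P ∧ x.1.1 + dir (x.2 + 5) ∈ P

instance : DecidablePred (IsInner P) := fun _ => by unfold IsInner; infer_instance

theorem isInner_step (x : P × Fin 6) : IsInner P (step P x) ↔ IsInner P x := by
  obtain ⟨⟨p, hp⟩, k⟩ := x
  by_cases h : p + dir k ∈ P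
  · rw [step_of_mem hp h]
    simp only [IsInner, add_dir_add_dir_add_four, h, true_and]
    rw [show k + 4 + 5 = k + 3 from add_assoc k 4 5, add_dir_add_dir_add_three]
    simp [hp]
  · rw [step_of_notMem hp h]
    simp only [IsInner, h, false_and, iff_false, not_and]
    rw [show k + 1 + 5 = k from (add_assoc k 1 5).trans (add_zero k)]
    exact fun _ => h

theorem step_step_step_of_isInner {x : P × Fin 6} (hx : IsInner P x) :
    step P (step P (step P x)) = x := by
  obtain ⟨⟨p, hp⟩, k⟩ := x
  obtain ⟨h1, h2⟩ := hx
  simp only at h1 h2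
  have h3 : p + dir k + dir (k + 4) ∈ P := by rwa [add_dir_add_dir_add_four]
  have h4 : p + dir k + dir (k + 4) + dir (k + 4 + 4) = p := by
    rw [show k + 4 + 4 = k + 2 from add_assoc k 4 4, add_dir_add_dir_add_four,
      add_dir_add_five_add_dir]
  rw [step_of_mem hp h1, step_of_mem h1 h3, step_of_mem h3 (by rwa [h4])]
  ext1
  · exact Subtype.ext h4
  · change k + 4 + 4 + 4 = k
    rw [add_assoc, add_assoc]
    exact add_zero k

theorem sign_rot : Equiv.Perm.sign (rot P) = (-1) ^ P.card := by
  rw [rot, Equiv.Perm.sign_prodCongrRight,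
    show Equiv.Perm.sign (Equiv.addRight (1 : Fin 6)) = -1 by decide]
  simp

/-- The number of ordered pairs of adjacent hexagons of `P`. -/
def pairCount (P : Finset Hexagon) : ℕ := ∑ p ∈ P, ∑ k, if p + dir k ∈ P then 1 else 0

/-- The number of triples of mutually adjacent hexagons of `P`, each counted three times. -/
def tripleCount (P : Finset Hexagon) : ℕ :=
  ∑ p ∈ P, ∑ k, if p + dir k ∈ P ∧ p + dir (k + 5) ∈ P then 1 else 0

theorem sign_turn : Equiv.Perm.sign (turn P) = (-1) ^ (pairCount P / 2) := by
  rw [Equiv.Perm.sign_of_pow_two_eq_one]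
  · have h : ∀ x, x ∈ Function.fixedPoints (turn P) ↔ ¬ (x.1.1 + dir x.2 ∈ P) := by
      rintro ⟨⟨p, hp⟩, k⟩
      by_cases h : p + dir k ∈ P
      · have : turn P (⟨p, hp⟩, k) = (⟨p + dir k, h⟩, k + 3) := dif_pos h
        simp [Function.mem_fixedPoints, Function.IsFixedPt, this, h]
      · have : turn P (⟨p, hp⟩, k) = (⟨p, hp⟩, k) := dif_neg h
        simp [Function.mem_fixedPoints, Function.IsFixedPt, this, h]
    have h2 : pairCount P = Fintype.card {x : P × Fin 6 // x.1.1 + dir x.2 ∈ P} := by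
      rw [Fintype.card_subtype, Finset.card_filter, Fintype.sum_prod_type, pairCount,
        ← Finset.sum_coe_sort P]
    have h3 : Fintype.card (Function.fixedPoints (turn P)) =
        Fintype.card {x : P × Fin 6 // ¬ (x.1.1 + dir x.2 ∈ P)} :=
      Fintype.card_congr (Equiv.subtypeEquivRight h)
    rw [h3, ← Fintype.card_subtype_compl, h2]
    congr 2
    convert rfl using 2
    simp
  · ext1 x
    rw [pow_two]
    exact Function.Involutive.toPerm_involutive _ x

/-! ### The parity of the number of loops -/

/-- The first edge of `∂P` among the edges at the initial vertex of a dart, rotating around this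
vertex through `P`.  It lies in `∂P` unless the vertex is inner. -/
def outEdge (P : Finset Hexagon) (x : P × Fin 6) : Edge :=
  if x.1.1 + dir x.2 ∈ P then dartEdge (x.1.1 + dir x.2) (x.2 + 4) else dartEdge x.1 x.2

theorem outEdge_of_mem {p : Hexagon} {hp : p ∈ P} {k : Fin 6} (h : p + dir k ∈ P) :
    outEdge P (⟨p, hp⟩, k) = dartEdge (p + dir k) (k + 4) := if_pos h

theorem outEdge_of_notMem {p : Hexagon} {hp : p ∈ P} {k : Fin 6} (h : p + dir k ∉ P) :
    outEdge P (⟨p, hp⟩, k) = dartEdge p k := if_neg h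

theorem outEdge_mem_boundary {x : P × Fin 6} (hx : ¬IsInner P x) : outEdge P x ∈ boundary P := by
  obtain ⟨⟨p, hp⟩, k⟩ := x
  by_cases h : p + dir k ∈ P
  · rw [outEdge_of_mem h, dartEdge_mem_boundary, add_dir_add_dir_add_four]
    intro h'
    exact hx ⟨h, h'.1 h⟩
  · rw [outEdge_of_notMem h, dartEdge_mem_boundary]
    intro h'
    exact h (h'.1 hp)

theorem corner_eq_end_dartEdge (p : Hexagon) (k : Fin 6) :
    corner p k = (dartEdge p k).blackEnd ∨ corner p k = (dartEdge p k).whiteEnd := by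
  rcases ends_dartEdge p k with h | h
  · exact Or.inl h.1.symm
  · exact Or.inr h.2.symm

theorem corner_add_one_eq_end_dartEdge (p : Hexagon) (k : Fin 6) :
    corner p (k + 1) = (dartEdge p k).blackEnd ∨ corner p (k + 1) = (dartEdge p k).whiteEnd := by
  rcases ends_dartEdge p k with h | h
  · exact Or.inr h.2.symm
  · exact Or.inl h.1.symm

theorem corner_eq_end_outEdge (x : P × Fin 6) :
    corner x.1 x.2 = (outEdge P x).blackEnd ∨ corner x.1 x.2 = (outEdge P x).whiteEnd := by
  obtain ⟨⟨p, hp⟩, k⟩ := x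
  by_cases h : p + dir k ∈ P
  · rw [outEdge_of_mem h, (corner_eq_iff p _ k _).2 (Or.inr (Or.inl ⟨rfl, rfl⟩))]
    exact corner_eq_end_dartEdge _ _
  · rw [outEdge_of_notMem h]
    exact corner_eq_end_dartEdge _ _

/-- The graph of the edges in `∂P`, whose connected components are counted by `loopCount`. -/
abbrev boundaryGraph (P : Finset Hexagon) : SimpleGraph (boundary P : Set Edge) :=
  edgeGraph.induce (boundary P : Set Edge)

/-- The darts whose initial vertex lies on `∂P`. -/
abbrev OuterDart (P : Finset Hexagon) : Type := {x : P × Fin 6 // ¬IsInner P x}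

/-- `outEdge`, as a vertex of the graph of `∂P`. -/
def outVertex (x : OuterDart P) : (boundary P : Set Edge) :=
  ⟨outEdge P x.1, outEdge_mem_boundary x.2⟩

/-- `step` on the darts that start at `∂P`.  Its cycles are the loops of `∂P`. -/
def outerStep (P : Finset Hexagon) : Equiv.Perm (OuterDart P) :=
  (step P).subtypePerm fun x => not_congr (isInner_step x)

theorem outerStep_val (x : OuterDart P) : (outerStep P x).1 = step P x.1 := rfl

theorem reachable_of_common_end {x y : (boundary P : Set Edge)} {v : Vertex}
    (hx : v = x.1.blackEnd ∨ v = x.1.whiteEnd) (hy : v = y.1.blackEnd ∨ v = y.1.whiteEnd) :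
    (boundaryGraph P).Reachable x y := by
  by_cases h : x = y
  · rw [h]
  · refine SimpleGraph.Adj.reachable ?_
    refine ⟨fun h' => h (Subtype.ext h'), ?_⟩
    rcases hx with rfl | rfl <;> rcases hy with h' | h'
    · exact Or.inl h'
    · cases h'
    · cases h'
    · exact Or.inr h'

theorem reachable_outVertex_outerStep (x : OuterDart P) :
    (boundaryGraph P).Reachable (outVertex (outerStep P x)) (outVertex x) := by
  obtain ⟨⟨⟨p, hp⟩, k⟩, hx⟩ := x
  by_cases h : p + dir k ∈ P
  · have h2 : p + dir k + dir (k + 4) ∉ P := by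
      rw [add_dir_add_dir_add_four]
      exact fun h' => hx ⟨h, h'⟩
    have : outVertex (outerStep P ⟨(⟨p, hp⟩, k), hx⟩) = outVertex ⟨(⟨p, hp⟩, k), hx⟩ := by
      refine Subtype.ext ?_
      simp only [outVertex, outerStep_val, step_of_mem hp h]
      rw [outEdge_of_mem h, outEdge_of_notMem h2]
    rw [this]
  · refine reachable_of_common_end (v := corner p (k + 1)) ?_ ?_
    · have := corner_eq_end_outEdge (outerStep P ⟨(⟨p, hp⟩, k), hx⟩).1
      rw [outerStep_val, step_of_notMem hp h] at this
      simp only [outVertex, outerStep_val, step_of_notMem hp h]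
      exact this
    · simp only [outVertex, outEdge_of_notMem h]
      exact corner_add_one_eq_end_dartEdge p k

theorem sameCycle_of_step_eq {x y : OuterDart P} (h : step P x.1 = y.1) :
    (outerStep P).SameCycle x y := by
  rw [← show outerStep P x = y from Subtype.ext h]
  exact Equiv.Perm.sameCycle_apply_right.2 (Equiv.Perm.SameCycle.refl _ _)

theorem reachable_of_sameCycle {x y : OuterDart P} (h : (outerStep P).SameCycle x y) :
    (boundaryGraph P).Reachable (outVertex x) (outVertex y) := by
  have hn : ∀ (n : ℕ) z, (boundaryGraph P).Reachable (outVertex (((outerStep P) ^ n) z))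
      (outVertex z) := by
    intro n
    induction n with
    | zero => exact fun z => SimpleGraph.Reachable.refl _
    | succ n ih =>
      intro z
      rw [pow_succ', Equiv.Perm.mul_apply]
      exact (reachable_outVertex_outerStep _).trans (ih z)
  obtain ⟨n, rfl⟩ := h.exists_nat_pow_eq
  exact (hn n x).symm

/-- Every dart that starts at `∂P` is on the cycle of a dart whose edge lies in `∂P`, namely of the
dart of its `outEdge`. -/
theorem exists_boundaryDart (x : OuterDart P) : ∃ p, ∃ hp : p ∈ P, ∃ k, ∃ h : p + dir k ∉ P,
    (outerStep P).SameCycle x ⟨(⟨p, hp⟩, k), fun h' => h h'.1⟩ ∧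
      (outVertex x).1 = dartEdge p k := by
  obtain ⟨⟨⟨p, hp⟩, k⟩, hx⟩ := x
  by_cases h : p + dir k ∈ P
  · have h2 : p + dir k + dir (k + 4) ∉ P := by
      rw [add_dir_add_dir_add_four]
      exact fun h' => hx ⟨h, h'⟩
    refine ⟨_, h, _, h2, ?_, outEdge_of_mem h⟩
    exact sameCycle_of_step_eq (step_of_mem hp h)
  · exact ⟨p, hp, k, h, Equiv.Perm.SameCycle.refl _ _, outEdge_of_notMem h⟩

/-- Of the darts of `∂P`, at most one starts at a given vertex. -/
theorem boundaryDart_eq_of_corner_eq {p q : Hexagon} {k l : Fin 6} (hp : p ∈ P)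
    (hpk : p + dir k ∉ P) (hq : q ∈ P) (hql : q + dir l ∉ P) (h : corner p k = corner q l) :
    q = p ∧ l = k := by
  rcases (corner_eq_iff _ _ _ _).1 h with h | ⟨rfl, rfl⟩ | ⟨rfl, rfl⟩
  · exact h
  · exact absurd hq hpk
  · rw [add_dir_add_five_add_dir] at hql
    exact absurd hp hql

/-- Of the darts of `∂P`, at most one ends at a given vertex. -/
theorem boundaryDart_eq_of_corner_add_one_eq {p q : Hexagon} {k l : Fin 6} (hp : p ∈ P)
    (hpk : p + dir k ∉ P) (hq : q ∈ P) (hql : q + dir l ∉ P)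
    (h : corner p (k + 1) = corner q (l + 1)) : q = p ∧ l = k := by
  rcases (corner_eq_iff _ _ _ _).1 h with ⟨h, h'⟩ | ⟨rfl, h'⟩ | ⟨rfl, -⟩
  · exact ⟨h, add_right_cancel h'⟩
  · have h2 : l = k + 1 + 3 := by
      rw [add_assoc k 1 4] at h'
      rw [add_assoc k 1 3]
      exact add_right_cancel (h'.trans (add_assoc k 4 1).symm)
    rw [h2, add_dir_add_dir_add_three] at hql
    exact absurd hp hql
  · rw [show k + 1 + 5 = k from (add_assoc k 1 5).trans (add_zero k)] at hq
    exact absurd hq hpk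

/-- The dart of `∂P` that starts where another one ends is on the same cycle. -/
theorem sameCycle_of_corner_add_one_eq {p q : Hexagon} {k l : Fin 6} (hp : p ∈ P)
    (hpk : p + dir k ∉ P) (hq : q ∈ P) (hql : q + dir l ∉ P)
    (h : corner p (k + 1) = corner q l) :
    (outerStep P).SameCycle ⟨(⟨p, hp⟩, k), fun h' => hpk h'.1⟩
      ⟨(⟨q, hq⟩, l), fun h' => hql h'.1⟩ := by
  have h1 := step_of_notMem hp hpk
  rcases (corner_eq_iff _ _ _ _).1 h with ⟨rfl, rfl⟩ | ⟨rfl, rfl⟩ | ⟨rfl, -⟩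
  · exact sameCycle_of_step_eq h1
  · refine (sameCycle_of_step_eq (y := outerStep P _) rfl).trans (sameCycle_of_step_eq ?_)
    rw [outerStep_val, h1, step_of_mem hp hq]
  · rw [show k + 1 + 5 = k from (add_assoc k 1 5).trans (add_zero k)] at hq
    exact absurd hq hpk

theorem sameCycle_of_dartEdge_eq_or_adj {p q : Hexagon} {k l : Fin 6} (hp : p ∈ P)
    (hpk : p + dir k ∉ P) (hq : q ∈ P) (hql : q + dir l ∉ P)
    (h : dartEdge p k = dartEdge q l ∨ edgeGraph.Adj (dartEdge p k) (dartEdge q l)) :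
    (outerStep P).SameCycle ⟨(⟨p, hp⟩, k), fun h' => hpk h'.1⟩
      ⟨(⟨q, hq⟩, l), fun h' => hql h'.1⟩ := by
  have h' : corner p k = corner q l ∨ corner p (k + 1) = corner q (l + 1) ∨
      corner p (k + 1) = corner q l ∨ corner p k = corner q (l + 1) := by
    rcases h with h | ⟨-, h⟩ <;>
    rcases ends_dartEdge p k with ⟨h1, h2⟩ | ⟨h1, h2⟩ <;>
    rcases ends_dartEdge q l with ⟨h3, h4⟩ | ⟨h3, h4⟩ <;>
    rw [← h1, ← h2, ← h3, ← h4] <;>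
    first
    | (rw [h]; simp)
    | (rcases h with h | h <;> rw [h] <;> simp)
  rcases h' with h' | h' | h' | h'
  · obtain ⟨rfl, rfl⟩ := boundaryDart_eq_of_corner_eq hp hpk hq hql h'
    exact Equiv.Perm.SameCycle.refl _ _
  · obtain ⟨rfl, rfl⟩ := boundaryDart_eq_of_corner_add_one_eq hp hpk hq hql h'
    exact Equiv.Perm.SameCycle.refl _ _
  · exact sameCycle_of_corner_add_one_eq hp hpk hq hql h'
  · exact (sameCycle_of_corner_add_one_eq hq hql hp hpk h'.symm).symm

theorem sameCycle_of_outVertex_eq_or_adj {x y : OuterDart P}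
    (h : outVertex x = outVertex y ∨ (boundaryGraph P).Adj (outVertex x) (outVertex y)) :
    (outerStep P).SameCycle x y := by
  obtain ⟨p, hp, k, hpk, hx, hxe⟩ := exists_boundaryDart x
  obtain ⟨q, hq, l, hql, hy, hye⟩ := exists_boundaryDart y
  refine hx.trans (Equiv.Perm.SameCycle.trans ?_ hy.symm)
  apply sameCycle_of_dartEdge_eq_or_adj
  rw [← hxe, ← hye]
  exact h.imp (congrArg _) id

theorem outVertex_surjective : Function.Surjective (outVertex (P := P)) := by
  rintro ⟨e, he⟩
  obtain ⟨p, k, rfl⟩ := exists_dartEdge_eq e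
  have h := (dartEdge_mem_boundary P p k).1 he
  by_cases hp : p ∈ P
  · have h2 : p + dir k ∉ P := fun h' => h (iff_of_true hp h')
    exact ⟨⟨(⟨p, hp⟩, k), fun h' => h2 h'.1⟩, Subtype.ext (outEdge_of_notMem h2)⟩
  · have h2 : p + dir k ∈ P := by
      by_contra h'
      exact h (iff_of_false hp h')
    have h3 : p + dir k + dir (k + 3) ∉ P := by rwa [add_dir_add_dir_add_three]
    refine ⟨⟨(⟨_, h2⟩, k + 3), fun h' => h3 h'.1⟩, Subtype.ext ?_⟩
    exact (outEdge_of_notMem h3).trans (dartEdge_opposite p k)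

theorem sameCycle_of_reachable {x y : OuterDart P}
    (h : (boundaryGraph P).Reachable (outVertex x) (outVertex y)) :
    (outerStep P).SameCycle x y := by
  obtain ⟨w⟩ := h
  generalize ha : outVertex x = a at w
  generalize hb : outVertex y = b at w
  induction w generalizing x with
  | nil => exact sameCycle_of_outVertex_eq_or_adj (Or.inl (ha.trans hb.symm))
  | cons hadj w ih =>
    rename_i u v _
    obtain ⟨z, hz⟩ := outVertex_surjective v
    refine (sameCycle_of_outVertex_eq_or_adj (y := z) (Or.inr ?_)).trans (ih hz hb)
    rwa [ha, hz]

theorem sign_outerStep :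
    Equiv.Perm.sign (outerStep P) = (-1) ^ (Fintype.card (OuterDart P) + loopCount P) := by
  classical
  have : Fintype (boundaryGraph P).ConnectedComponent := Fintype.ofFinite _
  rw [loopCount, Nat.card_eq_fintype_card]
  refine sign_eq_of_fibers_eq_cycles _
    (fun x => (boundaryGraph P).connectedComponentMk (outVertex x)) ?_ fun x y => ?_
  · intro c
    induction c using SimpleGraph.ConnectedComponent.ind with
    | _ v =>
      obtain ⟨x, rfl⟩ := outVertex_surjective v
      exact ⟨x, rfl⟩
  · rw [SimpleGraph.ConnectedComponent.eq]
    exact ⟨sameCycle_of_reachable, reachable_of_sameCycle⟩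

/-- The cycles of length three around the inner vertices do not contribute to the sign. -/
theorem sign_step_eq_sign_outerStep :
    Equiv.Perm.sign (step P) = Equiv.Perm.sign (outerStep P) := by
  have h : step P = ((step P).subtypePerm isInner_step).subtypeCongr (outerStep P) := by
    ext1 x
    by_cases hx : IsInner P x
    · rw [Equiv.Perm.subtypeCongr.left_apply _ _ hx]; rfl
    · rw [Equiv.Perm.subtypeCongr.right_apply _ _ hx]; rfl
  have h3 : ((step P).subtypePerm isInner_step) ^ 3 = 1 := by
    ext1 x
    exact Subtype.ext (step_step_step_of_isInner x.2)
  have h1 : Equiv.Perm.sign ((step P).subtypePerm isInner_step) = 1 := by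
    have := congrArg Equiv.Perm.sign h3
    rw [map_pow, map_one] at this
    rcases Int.units_eq_one_or (Equiv.Perm.sign ((step P).subtypePerm isInner_step)) with h | h
    · exact h
    · rw [h] at this
      exact absurd this (by decide)
  conv_lhs => rw [h]
  rw [Equiv.Perm.sign_subtypeCongr, h1, one_mul]

/-- The number of loops has the parity of the Euler characteristic of the interior of `P`: hexagons,
minus edges between two hexagons of `P`, plus vertices between three (which `tripleCount` counts
three times, with the same parity).  Both sides compute the sign of `step P`. -/
theorem neg_one_pow_loopCount (P : Finset Hexagon) :
    (-1 : ℤˣ) ^ loopCount P = (-1) ^ (P.card + pairCount P / 2 + tripleCount P) := by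
  have h1 : Fintype.card {x : P × Fin 6 // IsInner P x} = tripleCount P := by
    rw [Fintype.card_subtype, Finset.card_filter, Fintype.sum_prod_type, tripleCount,
      ← Finset.sum_coe_sort P]
    rfl
  have h2 : Fintype.card (OuterDart P) + tripleCount P = P.card * 6 := by
    have h0 := Fintype.card_subtype_le fun x : P × Fin 6 => IsInner P x
    rw [← h1, Fintype.card_subtype_compl, Nat.sub_add_cancel h0]
    simp
  have h3 : (-1 : ℤˣ) ^ Fintype.card (OuterDart P) = (-1) ^ tripleCount P := by
    have : (-1 : ℤˣ) ^ (Fintype.card (OuterDart P) + tripleCount P) = 1 := by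
      rw [h2, mul_comm, pow_mul, show (-1 : ℤˣ) ^ 6 = 1 by decide, one_pow]
    rw [pow_add] at this
    have h4 : (-1 : ℤˣ) ^ tripleCount P * (-1) ^ tripleCount P = 1 := Int.units_mul_self _
    exact mul_right_cancel (this.trans h4.symm)
  have h4 := sign_step_eq_sign_outerStep (P := P)
  rw [sign_outerStep, step, map_mul, sign_rot, sign_turn, pow_add _ _ (loopCount P), h3] at h4
  rw [pow_add, pow_add, h4, mul_right_comm, Int.units_mul_self, one_mul]

end

/-! ### The local rule for the sign of a region -/

/-- The edge that meets the hexagon `p` at its `k`-th vertex, without belonging to it. -/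
def leg (p : Hexagon) (k : Fin 6) : Edge := dartEdge (p + dir k) (k + 4)

/-- The factor by which the sign `(-1) ^ ♯Π` changes when the hexagon `p` is added to or removed
from a region with boundary `α`; it depends on the legs of `p` only. -/
def legPhase (p : Hexagon) (α : Finset Edge) : ℂ := -∏ k, if leg p k ∈ α then Complex.I else 1

theorem leg_mem_boundary (P : Finset Hexagon) (p : Hexagon) (k : Fin 6) :
    leg p k ∈ boundary P ↔ ¬(p + dir k ∈ P ↔ p + dir (k + 5) ∈ P) := by
  rw [leg, dartEdge_mem_boundary, add_dir_add_dir_add_four]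

theorem leg_notMem_edges (p : Hexagon) (k : Fin 6) : leg p k ∉ p.edges := by
  rw [leg, dartEdge_mem_edges_iff, add_dir_add_dir_add_four, not_or]
  exact ⟨(add_dir_ne_self p k).symm, (add_dir_ne_self p _).symm⟩

theorem legPhase_symmDiff_edges (p : Hexagon) (α : Finset Edge) :
    legPhase p (α ∆ p.edges) = legPhase p α := by
  simp [legPhase, Finset.mem_symmDiff, leg_notMem_edges]

theorem add_dir_eq_iff (p q : Hexagon) (k : Fin 6) : q + dir k = p ↔ q = p + dir (k + 3) := by
  constructor
  · rintro rfl
    exact (add_dir_add_dir_add_three q k).symm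
  · rintro rfl
    have := add_dir_add_dir_add_three p (k + 3)
    rwa [show k + 3 + 3 = k from (add_assoc k 3 3).trans (add_zero k)] at this

theorem dir_ne_zero : ∀ k, dir k ≠ 0 := by decide

theorem pairCount_insert {P : Finset Hexagon} {p : Hexagon} (hp : p ∉ P) :
    pairCount (insert p P) = pairCount P + 2 * ∑ k, if p + dir k ∈ P then 1 else 0 := by
  have h1 : ∀ q ∈ P, ∀ k, (if q + dir k ∈ insert p P then 1 else 0) =
      (if q + dir k ∈ P then 1 else 0) + if q = p + dir (k + 3) then 1 else 0 := by
    intro q _ k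
    simp only [← add_dir_eq_iff, Finset.mem_insert]
    by_cases h : q + dir k = p
    · simp [h, hp]
    · simp [h]
  have h2 : ∑ q ∈ P, ∑ k : Fin 6, (if q = p + dir (k + 3) then 1 else 0) =
      ∑ k, if p + dir k ∈ P then 1 else 0 := by
    rw [Finset.sum_comm, ← Equiv.sum_comp (Equiv.addRight (3 : Fin 6))
      fun k => if p + dir k ∈ P then 1 else 0]
    exact Finset.sum_congr rfl fun k _ => Finset.sum_ite_eq' _ _ _
  rw [pairCount, Finset.sum_insert hp, Finset.sum_congr rfl fun q hq =>
    Finset.sum_congr rfl fun k _ => h1 q hq k]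
  simp only [Finset.sum_add_distrib, h2, Finset.mem_insert, add_dir_ne_self, false_or]
  rw [pairCount]
  ring

theorem tripleCount_insert {P : Finset Hexagon} {p : Hexagon} (hp : p ∉ P) :
    tripleCount (insert p P) = tripleCount P +
      3 * ∑ k, if p + dir k ∈ P ∧ p + dir (k + 5) ∈ P then 1 else 0 := by
  have h1 : ∀ q ∈ P, ∀ k,
      (if q + dir k ∈ insert p P ∧ q + dir (k + 5) ∈ insert p P then 1 else 0) =
      (if q + dir k ∈ P ∧ q + dir (k + 5) ∈ P then 1 else 0) +
      (if q = p + dir (k + 3) then if p + dir (k + 4) ∈ P then 1 else 0 else 0) +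
      if q = p + dir (k + 2) then if p + dir (k + 1) ∈ P then 1 else 0 else 0 := by
    intro q _ k
    have e1 : q + dir (k + 5) = p ↔ q = p + dir (k + 2) := by
      rw [add_dir_eq_iff, show k + 5 + 3 = k + 2 from add_assoc k 5 3]
    have e0 := add_dir_eq_iff p q k
    have e2 : q + dir k = p → q + dir (k + 5) = p + dir (k + 4) := by
      intro h
      rw [e0] at h
      rw [h]
      obtain ⟨a, b⟩ := p
      fin_cases k <;> simp [dir]
    have e3 : q + dir (k + 5) = p → q + dir k = p + dir (k + 1) := by
      intro h
      rw [e1] at h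
      rw [h]
      obtain ⟨a, b⟩ := p
      fin_cases k <;> simp [dir]
    simp only [← e1, ← e0, Finset.mem_insert]
    by_cases h : q + dir k = p
    · simp [h, hp, e2 h, dir_ne_zero]
    · by_cases h' : q + dir (k + 5) = p
      · simp [h', hp, e3 h', dir_ne_zero]
      · simp [h, h']
  have h2 : ∑ q ∈ P, ∑ k : Fin 6,
      (if q = p + dir (k + 3) then if p + dir (k + 4) ∈ P then 1 else 0 else 0) =
      ∑ k, if p + dir k ∈ P ∧ p + dir (k + 5) ∈ P then 1 else 0 := by
    rw [Finset.sum_comm, ← Equiv.sum_comp (Equiv.addRight (4 : Fin 6))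
      fun k => if p + dir k ∈ P ∧ p + dir (k + 5) ∈ P then 1 else 0]
    refine Finset.sum_congr rfl fun k _ => ?_
    rw [Finset.sum_ite_eq']
    simp only [Equiv.coe_addRight, show k + 4 + 5 = k + 3 from add_assoc k 4 5,
      and_comm (a := p + dir (k + 4) ∈ P), ite_and]
  have h3 : ∑ q ∈ P, ∑ k : Fin 6,
      (if q = p + dir (k + 2) then if p + dir (k + 1) ∈ P then 1 else 0 else 0) =
      ∑ k, if p + dir k ∈ P ∧ p + dir (k + 5) ∈ P then 1 else 0 := by
    rw [Finset.sum_comm, ← Equiv.sum_comp (Equiv.addRight (2 : Fin 6))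
      fun k => if p + dir k ∈ P ∧ p + dir (k + 5) ∈ P then 1 else 0]
    refine Finset.sum_congr rfl fun k _ => ?_
    rw [Finset.sum_ite_eq']
    simp only [Equiv.coe_addRight, show k + 2 + 5 = k + 1 from add_assoc k 2 5, ite_and]
  rw [tripleCount, Finset.sum_insert hp, Finset.sum_congr rfl fun q hq =>
    Finset.sum_congr rfl fun k _ => h1 q hq k]
  simp only [Finset.sum_add_distrib, h2, h3, Finset.mem_insert, add_dir_ne_self, false_or]
  rw [tripleCount]
  ring

/-- For six bits in cyclic order, the product of a factor `I` for every change of value is a sign,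
and the number of ones and of pairs of consecutive ones determines it. -/
theorem neg_prod_I_of_ne (b : Fin 6 → Prop) [DecidablePred b] :
    (-1 : ℂ) ^ (1 + ∑ k, (if b k then 1 else 0) +
      3 * ∑ k : Fin 6, if b k ∧ b (k + 5) then 1 else 0) =
    -∏ k : Fin 6, if ¬(b k ↔ b (k + 5)) then Complex.I else 1 := by
  have h : ∀ k, (if ¬(b k ↔ b (k + 5)) then Complex.I else 1) =
      (if b k then Complex.I else 1) * (if b (k + 5) then Complex.I else 1) *
        if b k ∧ b (k + 5) then -1 else 1 := by
    intro k
    -- If both bits are one, the two factors `I` have to be compensated.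
    by_cases h1 : b k <;> by_cases h2 : b (k + 5) <;> simp [h1, h2]
  have h2 : ∏ k : Fin 6, (if b (k + 5) then Complex.I else 1) =
      ∏ k, if b k then Complex.I else 1 :=
    Equiv.prod_comp (Equiv.addRight (5 : Fin 6)) fun k => if b k then Complex.I else 1
  simp only [h, Finset.prod_mul_distrib, h2]
  rw [← Finset.prod_mul_distrib]
  simp only [pow_add, pow_mul, ← Finset.prod_pow_eq_pow_sum]
  rw [pow_one, neg_one_mul, neg_mul, show (-1 : ℂ) ^ 3 = -1 by norm_num]
  congr 2 <;> refine Finset.prod_congr rfl fun k _ => ?_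
  · by_cases h1 : b k <;> simp [h1]
  · split_ifs <;> simp

theorem neg_one_pow_loopCount_insert {P : Finset Hexagon} {p : Hexagon} (hp : p ∉ P) :
    (-1 : ℂ) ^ loopCount (insert p P) = (-1) ^ loopCount P * legPhase p (boundary P) := by
  have h : ∀ Q : Finset Hexagon, (-1 : ℂ) ^ loopCount Q =
      (-1) ^ (Q.card + pairCount Q / 2 + tripleCount Q) := fun Q => by
    have := congrArg (fun u : ℤˣ => ((u : ℤ) : ℂ)) (neg_one_pow_loopCount Q)
    simpa using this
  simp only [legPhase, leg_mem_boundary]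
  rw [h, h, pairCount_insert hp, tripleCount_insert hp, Finset.card_insert_of_notMem hp,
    Nat.add_mul_div_left _ _ two_pos, ← neg_prod_I_of_ne fun k => p + dir k ∈ P, ← pow_add]
  congr 1
  ring

theorem symmDiff_singleton_of_mem {P : Finset Hexagon} {p : Hexagon} (hp : p ∈ P) :
    P ∆ {p} = P.erase p := by
  ext q
  simp only [Finset.mem_symmDiff, Finset.mem_singleton, Finset.mem_erase]
  grind

theorem symmDiff_singleton_of_notMem {P : Finset Hexagon} {p : Hexagon} (hp : p ∉ P) :
    P ∆ {p} = insert p P := by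
  ext q
  simp only [Finset.mem_symmDiff, Finset.mem_singleton, Finset.mem_insert]
  grind

theorem boundary_symmDiff_singleton (P : Finset Hexagon) (p : Hexagon) :
    boundary (P ∆ {p}) = boundary P ∆ p.edges := by
  by_cases hp : p ∈ P
  · have h := boundary_insert (Finset.notMem_erase p P)
    rw [Finset.insert_erase hp] at h
    rw [symmDiff_singleton_of_mem hp, h, symmDiff_symmDiff_cancel_right]
  · rw [symmDiff_singleton_of_notMem hp, boundary_insert hp]

/-- On boundaries the phase is a sign, because an even number of legs is occupied. -/
theorem legPhase_boundary_mul_self (P : Finset Hexagon) (p : Hexagon) :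
    legPhase p (boundary P) * legPhase p (boundary P) = 1 := by
  simp only [legPhase, leg_mem_boundary]
  rw [← neg_prod_I_of_ne fun k => p + dir k ∈ P, ← mul_pow]
  simp

/-- The local rule for the sign of the double semion vectors. -/
theorem neg_one_pow_loopCount_symmDiff_singleton (P : Finset Hexagon) (p : Hexagon) :
    (-1 : ℂ) ^ loopCount (P ∆ {p}) = (-1) ^ loopCount P * legPhase p (boundary P) := by
  by_cases hp : p ∈ P
  · have h := neg_one_pow_loopCount_insert (Finset.notMem_erase p P)
    rw [Finset.insert_erase hp, ← symmDiff_singleton_of_mem hp, boundary_symmDiff_singleton,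
      legPhase_symmDiff_edges] at h
    rw [h, mul_assoc, legPhase_boundary_mul_self, mul_one]
  · rw [symmDiff_singleton_of_notMem hp, neg_one_pow_loopCount_insert hp]

/-! ### Homology of the hexagonal lattice, modulo two -/

/-- The indicator function of a finite set, with values modulo two. -/
def ind {α : Type*} [DecidableEq α] (S : Finset α) (x : α) : ZMod 2 := if x ∈ S then 1 else 0

section ind

variable {α : Type*} [DecidableEq α]

theorem ind_symmDiff (S T : Finset α) (x : α) : ind (S ∆ T) x = ind S x + ind T x := by
  by_cases h1 : x ∈ S <;> by_cases h2 : x ∈ T <;> simp [ind, Finset.mem_symmDiff, h1, h2]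
  decide

theorem ind_injective : Function.Injective (ind : Finset α → α → ZMod 2) := by
  intro S T h
  ext x
  have := congrFun h x
  by_cases h1 : x ∈ S <;> by_cases h2 : x ∈ T <;> simp_all [ind]

theorem even_card_inter_iff (S T : Finset α) : Even (S ∩ T).card ↔ ∑ x ∈ T, ind S x = 0 := by
  rw [← ZMod.natCast_eq_zero_iff_even, Finset.inter_comm, ← Finset.filter_mem_eq_inter,
    Finset.card_filter]
  simp [ind]

end ind

theorem zmod_two_add_self (x : ZMod 2) : x + x = 0 := by
  revert x; decide

/-- A closed one-cochain with finite support on the square lattice, modulo two, is the coboundary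
of a finitely supported function: sum the values of `f` along the columns, from below. -/
theorem exists_primitive (f g : ℤ × ℤ → ZMod 2) (hf : f.support.Finite) (hg : g.support.Finite)
    (h : ∀ a b, f (a, b) + f (a - 1, b) = g (a, b) + g (a, b - 1)) :
    ∃ U : Finset (ℤ × ℤ), ∀ a b, f (a, b) = ind U (a, b) + ind U (a, b - 1) ∧
      g (a, b) = ind U (a, b) + ind U (a - 1, b) := by
  obtain ⟨N, hN⟩ : ∃ N : ℤ, ∀ a b, (a < -N ∨ N < a ∨ b < -N ∨ N < b) →
      f (a, b) = 0 ∧ g (a, b) = 0 := by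
    obtain ⟨N, hN⟩ := ((hf.union hg).image fun R : ℤ × ℤ => max |R.1| |R.2|).bddAbove
    refine ⟨N, fun a b hab => ?_⟩
    by_contra hne
    have hmem : (a, b) ∈ f.support ∪ g.support := by
      rw [Set.mem_union, Function.mem_support, Function.mem_support]
      tauto
    have := hN (Set.mem_image_of_mem _ hmem)
    simp only [max_le_iff, abs_le] at this
    omega
  let u : ℤ → ℤ → ZMod 2 := fun a b => ∑ b' ∈ Finset.Icc (-N) b, f (a, b')
  have hu_below : ∀ a b, b < -N → u a b = 0 := fun a b hb => by
    simp only [u, Finset.Icc_eq_empty (not_le.2 hb), Finset.sum_empty]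
  have hu_side : ∀ a b, (a < -N ∨ N < a) → u a b = 0 := fun a b ha =>
    Finset.sum_eq_zero fun b' _ => (hN a b' (by tauto)).1
  have huf : ∀ a b, u a b = f (a, b) + u a (b - 1) := by
    intro a b
    by_cases hb : b < -N
    · rw [hu_below a b hb, hu_below a _ (by omega), (hN a b (by tauto)).1, add_zero]
    · have : Finset.Icc (-N) b = insert b (Finset.Icc (-N) (b - 1)) := by
        ext c
        simp only [Finset.mem_Icc, Finset.mem_insert]
        omega
      simp only [u, this]
      rw [Finset.sum_insert (by simp)]
  -- The defect of the second equation is constant on columns and vanishes far below.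
  have hug : ∀ a b, u a b + u (a - 1) b + g (a, b) = 0 := by
    intro a b
    by_cases hb : b < -N
    · rw [hu_below a b hb, hu_below _ b hb, (hN a b (by tauto)).2]; rfl
    · have hle : -N - 1 ≤ b := by omega
      clear hb
      induction b, hle using Int.leInduction with
      | base =>
        rw [hu_below a _ (by omega), hu_below _ _ (by omega), (hN a _ (by omega)).2]; rfl
      | succ b _ ih =>
        have h1 := h a (b + 1)
        rw [huf a, huf (a - 1)]
        rw [add_sub_cancel_right] at *
        have e : f (a, b + 1) + u a b + (f (a - 1, b + 1) + u (a - 1) b) + g (a, b + 1) =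
            (f (a, b + 1) + f (a - 1, b + 1)) + g (a, b + 1) + g (a, b) +
              (u a b + u (a - 1) b + g (a, b)) - (g (a, b) + g (a, b)) := by ring
        rw [e, ih, h1, zmod_two_add_self]
        have e2 : g (a, b + 1) + g (a, b) + g (a, b + 1) + g (a, b) =
            (g (a, b + 1) + g (a, b + 1)) + (g (a, b) + g (a, b)) := by ring
        rw [e2, zmod_two_add_self, zmod_two_add_self]; rfl
  have hu_above : ∀ a b, N < b → u a b = 0 := by
    intro a b hb
    by_cases ha : a < -N
    · exact hu_side a b (Or.inl ha)
    · have hle : -N - 1 ≤ a := by omega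
      clear ha
      induction a, hle using Int.leInduction with
      | base => exact hu_side _ b (by omega)
      | succ a _ ih =>
        have := hug (a + 1) b
        rwa [add_sub_cancel_right, ih, (hN _ b (by tauto)).2, add_zero, add_zero] at this
  refine ⟨(Finset.Icc (-N) N ×ˢ Finset.Icc (-N) N).filter fun R => u R.1 R.2 = 1, ?_⟩
  have hU : ∀ a b, ind ((Finset.Icc (-N) N ×ˢ Finset.Icc (-N) N).filter
      fun R => u R.1 R.2 = 1) (a, b) = u a b := by
    intro a b
    by_cases hab : a < -N ∨ N < a ∨ b < -N ∨ N < b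
    · have h0 : u a b = 0 := by
        rcases hab with h | h | h | h
        · exact hu_side a b (Or.inl h)
        · exact hu_side a b (Or.inr h)
        · exact hu_below a b h
        · exact hu_above a b h
      simp [ind, h0]
    · have hmem : -N ≤ a ∧ a ≤ N ∧ -N ≤ b ∧ b ≤ N := by omega
      have h01 : ∀ x : ZMod 2, (if x = 1 then 1 else 0) = x := by decide
      simp [ind, hmem, h01]
  intro a b
  simp only [hU]
  constructor
  · rw [huf a b, add_assoc, zmod_two_add_self, add_zero]
  · have := hug a b
    rw [add_eq_zero_iff_neg_eq] at this
    rw [← this]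
    exact CharTwo.neg_eq _

theorem ind_boundary (P : Finset Hexagon) (p : Hexagon) (k : Fin 6) :
    ind (boundary P) (dartEdge p k) = ind P p + ind P (p + dir k) := by
  simp only [ind, dartEdge_mem_boundary]
  by_cases h1 : p ∈ P <;> by_cases h2 : p + dir k ∈ P <;> simp [h1, h2]
  decide

theorem ind_boundary_zero (P : Finset Hexagon) (a b : ℤ) :
    ind (boundary P) ((a, b), 0) = ind P (a, b) + ind P (a - 1, b + 1) :=
  ind_boundary P (a, b) 1

theorem ind_boundary_one (P : Finset Hexagon) (a b : ℤ) :
    ind (boundary P) ((a, b), 1) = ind P (a - 1, b + 1) + ind P (a - 1, b) := by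
  have := ind_boundary P (a - 1, b + 1) 5
  simpa [dartEdge, dir] using this

theorem ind_boundary_two (P : Finset Hexagon) (a b : ℤ) :
    ind (boundary P) ((a, b), 2) = ind P (a, b) + ind P (a - 1, b) := by
  have := ind_boundary P (a, b) 0
  simpa [dartEdge, dir, sub_eq_add_neg] using this

/-- The three edges at a vertex. -/
def vertexStar : Vertex → Finset Edge
  | .black R => {(R, 0), (R, 1), (R, 2)}
  | .white R => {(R, 0), (R + (1, 0), 1), (R + (0, 1), 2)}

theorem sum_star_black (c : Edge → ZMod 2) (a b : ℤ) : ∑ x ∈ vertexStar (.black (a, b)), c x =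
    c ((a, b), 0) + c ((a, b), 1) + c ((a, b), 2) := by
  rw [vertexStar, Finset.sum_insert (by simp), Finset.sum_pair (by simp), add_assoc]

theorem sum_star_white (c : Edge → ZMod 2) (a b : ℤ) : ∑ x ∈ vertexStar (.white (a, b)), c x =
    c ((a, b), 0) + c ((a + 1, b), 1) + c ((a, b + 1), 2) := by
  rw [vertexStar, Finset.sum_insert (by simp), Finset.sum_pair (by simp), add_assoc]
  simp

theorem sum_edges (c : Edge → ZMod 2) (a b : ℤ) : ∑ x ∈ Hexagon.edges (a, b), c x =
    c ((a, b), 2) + c ((a, b), 0) + c ((a + 1, b), 1) + c ((a + 1, b), 2) +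
      c ((a + 1, b - 1), 0) + c ((a + 1, b - 1), 1) := by
  rw [Hexagon.edges, Finset.sum_insert (by simp), Finset.sum_insert (by simp),
    Finset.sum_insert (by simp), Finset.sum_insert (by simp), Finset.sum_pair (by simp)]
  simp only [Prod.mk_add_mk, add_zero, ← sub_eq_add_neg, add_assoc]

theorem even_card_boundary_inter_star (P : Finset Hexagon) (v : Vertex) :
    Even (boundary P ∩ vertexStar v).card := by
  rw [even_card_inter_iff]
  obtain ⟨a, b⟩ | ⟨a, b⟩ := v
  · rw [sum_star_black, ind_boundary_zero, ind_boundary_one, ind_boundary_two]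
    generalize ind P _ = x
    generalize ind P _ = y
    generalize ind P _ = z
    revert x y z; decide
  · rw [sum_star_white, ind_boundary_zero, ind_boundary_one, ind_boundary_two]
    simp only [add_sub_cancel_right]
    generalize ind P (a, b) = x
    generalize ind P (a, b + 1) = y
    generalize ind P _ = z
    revert x y z; decide

theorem finite_support_ind_comp {α β : Type*} [DecidableEq α] (S : Finset α) {c : β → α}
    (hc : Function.Injective c) : (Function.support fun x => ind S (c x)).Finite := by
  refine (S.finite_toSet.preimage hc.injOn).subset fun x hx => ?_
  by_contra h
  exact hx (if_neg h)

/-- A finite set of edges that meets every vertex an even number of times bounds a finite set of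
hexagons. -/
theorem exists_eq_boundary {S : Finset Edge} (h : ∀ v, Even (S ∩ vertexStar v).card) :
    ∃ Q, S = boundary Q := by
  simp only [even_card_inter_iff] at h
  have hb := fun a b => h (.black (a, b))
  have hw := fun a b => h (.white (a, b))
  simp only [sum_star_black, sum_star_white] at hb hw
  obtain ⟨U, hU⟩ := exists_primitive (fun R => ind S ((R.1 + 1, R.2 - 1), 1))
    (fun R => ind S (R, 2))
    (finite_support_ind_comp S fun R R' hR => by
      simp only [Prod.mk.injEq, add_left_inj, sub_left_inj, and_true] at hR
      exact Prod.ext hR.1 hR.2)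
    (finite_support_ind_comp S fun R R' hR => (Prod.mk.inj hR).1) fun a b => by
      have h1 := hb a (b - 1)
      have h2 := hw a (b - 1)
      simp only [sub_add_cancel] at h1 h2 ⊢
      generalize ind S ((a, b - 1), 0) = x0 at *
      generalize ind S ((a, b - 1), 1) = x1 at *
      generalize ind S ((a, b - 1), 2) = x2 at *
      generalize ind S ((a + 1, b - 1), 1) = y1 at *
      generalize ind S ((a, b), 2) = y2 at *
      revert x0 x1 x2 y1 y2; decide
  refine ⟨U, ind_injective (funext ?_)⟩
  rintro ⟨⟨a, b⟩, i⟩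
  have h2 := (hU a b).2
  have h1 := (hU (a - 1) (b + 1)).1
  simp only [sub_add_cancel, add_sub_cancel_right] at h1 h2
  fin_cases i
  · have h0 := hb a b
    rw [h1, h2] at h0
    refine Eq.trans ?_ (ind_boundary_zero U a b).symm
    simp only [Fin.zero_eta]
    generalize ind S ((a, b), 0) = x at *
    generalize ind U (a, b) = y0 at *
    generalize ind U (a - 1, b) = y1 at *
    generalize ind U (a - 1, b + 1) = y2 at *
    clear h1 h2
    revert x y0 y1 y2; decide
  · exact h1.trans (ind_boundary_one U a b).symm
  · exact h2.trans (ind_boundary_two U a b).symm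

/-- A finite set of edges that meets every hexagon an even number of times is a sum of vertex stars,
modulo two; stated as an induction principle. -/
theorem star_induction {C : Finset Edge → Prop} (h0 : C ∅)
    (hstar : ∀ T v, C T → C (T ∆ vertexStar v)) {T : Finset Edge}
    (h : ∀ p : Hexagon, Even (T ∩ p.edges).card) : C T := by
  simp only [even_card_inter_iff] at h
  have hp := fun a b => h (a, b)
  simp only [sum_edges] at hp
  have hsum : ∀ B W : Finset (ℤ × ℤ), ∃ T', C T' ∧ ∀ a b,
      ind T' ((a, b), 0) = ind B (a, b) + ind W (a, b) ∧
      ind T' ((a, b), 1) = ind B (a, b) + ind W (a - 1, b) ∧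
      ind T' ((a, b), 2) = ind B (a, b) + ind W (a, b - 1) := by
    intro B W
    induction B using Finset.induction_on with
    | empty =>
      induction W using Finset.induction_on with
      | empty => exact ⟨∅, h0, by simp [ind]⟩
      | insert R W hR ih =>
        obtain ⟨T', hT, hi⟩ := ih
        refine ⟨_, hstar T' (.white R) hT, fun a b => ?_⟩
        have hs : ind (vertexStar (.white R)) ((a, b), 0) = ind {R} (a, b) ∧
            ind (vertexStar (.white R)) ((a, b), 1) = ind {R} (a - 1, b) ∧
            ind (vertexStar (.white R)) ((a, b), 2) = ind {R} (a, b - 1) := by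
          obtain ⟨c, d⟩ := R
          simp [ind, vertexStar, sub_eq_iff_eq_add]
        rw [← symmDiff_singleton_of_notMem hR]
        simp only [ind_symmDiff, hi, hs]
        refine ⟨?_, ?_, ?_⟩ <;> ring
    | insert R B hR ih =>
      obtain ⟨T', hT, hi⟩ := ih
      refine ⟨_, hstar T' (.black R) hT, fun a b => ?_⟩
      have hs : ∀ i, ind (vertexStar (.black R)) ((a, b), i) = ind {R} (a, b) := by
        intro i
        fin_cases i <;> simp [ind, vertexStar]
      rw [← symmDiff_singleton_of_notMem hR]
      simp only [ind_symmDiff, hi, hs]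
      refine ⟨?_, ?_, ?_⟩ <;> ring
  have hinj : ∀ i : Fin 3, Function.Injective fun R : ℤ × ℤ => ((R, i) : Edge) :=
    fun i R R' hR => (Prod.mk.inj hR).1
  have hfin : ∀ i : Fin 3,
      (Function.support fun R : ℤ × ℤ => ind T (R, i) + ind T (R, 0)).Finite := fun i =>
    ((finite_support_ind_comp T (hinj i)).union (finite_support_ind_comp T (hinj 0))).subset
      (Function.support_add _ _)
  obtain ⟨U, hU⟩ := exists_primitive _ _ (hfin 2) (hfin 1) fun a b => by
    have := hp (a - 1) b
    simp only [sub_add_cancel] at this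
    generalize ind T ((a, b), 0) = x0 at *
    generalize ind T ((a, b), 1) = x1 at *
    generalize ind T ((a, b), 2) = x2 at *
    generalize ind T ((a - 1, b), 0) = y0 at *
    generalize ind T ((a - 1, b), 2) = y2 at *
    generalize ind T ((a, b - 1), 0) = z0 at *
    generalize ind T ((a, b - 1), 1) = z1 at *
    revert x0 x1 x2 y0 y2 z0 z1; decide
  obtain ⟨T', hT, hi⟩ := hsum ((T.preimage (fun R => (R, 0)) (hinj 0).injOn) ∆ U) U
  suffices T = T' by rwa [this]
  refine ind_injective (funext ?_)
  have hpre : ∀ R, ind (T.preimage (fun R => ((R, 0) : Edge)) (hinj 0).injOn) R = ind T (R, 0) :=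
    fun R => by simp [ind]
  rintro ⟨⟨a, b⟩, i⟩
  obtain ⟨h2, h1⟩ := hU a b
  simp only [ind_symmDiff, hpre] at hi
  have hi := hi a b
  fin_cases i
  · refine Eq.trans ?_ hi.1.symm
    rw [add_assoc, zmod_two_add_self, add_zero]
    rfl
  · refine Eq.trans ?_ hi.2.1.symm
    rw [add_assoc, ← h1, add_comm (ind T ((a, b), 1)), ← add_assoc, zmod_two_add_self, zero_add]
    rfl
  · refine Eq.trans ?_ hi.2.2.symm
    rw [add_assoc, ← h2, add_comm (ind T ((a, b), 2)), ← add_assoc, zmod_two_add_self, zero_add]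
    rfl

/-- A finite region is determined by its boundary: two regions with the same boundary agree or are
complementary along each line of hexagons, and both are absent far away. -/
theorem boundary_injective : Function.Injective boundary := by
  intro P P' h
  have h3 : ∀ p : Hexagon, (p ∈ P ↔ p ∈ P') ↔ (p + (1, 0) ∈ P ↔ p + (1, 0) ∈ P') := by
    intro p
    have h1 := dartEdge_mem_boundary P p 3
    have h2 := dartEdge_mem_boundary P' p 3
    rw [h, h2] at h1
    change _ ↔ ¬ (p ∈ P ↔ p + (1, 0) ∈ P) at h1
    change ¬ (p ∈ P' ↔ p + (1, 0) ∈ P') ↔ _ at h1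
    tauto
  ext p
  have h4 : ∀ n : ℕ, (p ∈ P ↔ p ∈ P') ↔ (p + ((n : ℤ), 0) ∈ P ↔ p + ((n : ℤ), 0) ∈ P') := by
    intro n
    induction n with
    | zero =>
      rw [show p + (((0 : ℕ) : ℤ), (0 : ℤ)) = p from add_zero p]
    | succ n ih =>
      rw [ih, h3, add_assoc]
      simp
  have hinj : Function.Injective fun n : ℕ => p + ((n : ℤ), (0 : ℤ)) := fun m n hmn => by
    simpa using hmn
  obtain ⟨n, hn⟩ := Infinite.exists_notMem_finset ((P ∪ P').preimage _ hinj.injOn)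
  rw [Finset.mem_preimage, Finset.mem_union, not_or] at hn
  exact (h4 n).2 (iff_of_false hn.1 hn.2)

/-! ### Pauli operators -/

/-- The basis vector of the configuration `α`. -/
def ket (α : Finset Edge) : HilbertSpace := lp.single 2 α (1 : ℂ)

/-- The product of `σˣ` over the edges in `S`. -/
def xOp (S : Finset Edge) : HilbertSpace →L[ℂ] HilbertSpace :=
  monomialOp (Function.Involutive.toPerm (fun α => α ∆ S) fun α =>
    symmDiff_symmDiff_cancel_right S α) (fun _ => 1) fun _ => norm_one

/-- The diagonal operator with entries `c`. -/
def diagOp (c : Finset Edge → ℂ) (hc : ∀ α, ‖c α‖ = 1) : HilbertSpace →L[ℂ] HilbertSpace :=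
  monomialOp (Equiv.refl _) c hc

/-- The product of `σᶻ` over the edges in `T`. -/
def zOp (T : Finset Edge) : HilbertSpace →L[ℂ] HilbertSpace :=
  diagOp (fun α => (-1) ^ (T ∩ α).card) fun α => by simp

theorem op_mul_apply (a b : HilbertSpace →L[ℂ] HilbertSpace) (f : HilbertSpace) :
    (a * b) f = a (b f) := rfl

theorem xOp_apply (S : Finset Edge) (f : HilbertSpace) (α : Finset Edge) :
    xOp S f α = f (α ∆ S) := one_mul _

theorem diagOp_apply {c : Finset Edge → ℂ} (hc : ∀ α, ‖c α‖ = 1) (f : HilbertSpace)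
    (α : Finset Edge) : diagOp c hc f α = c α * f α := rfl

theorem zOp_apply (T : Finset Edge) (f : HilbertSpace) (α : Finset Edge) :
    zOp T f α = (-1) ^ (T ∩ α).card * f α := rfl

theorem ket_apply (α β : Finset Edge) : ket α β = if β = α then 1 else 0 := by
  rw [ket, lp.single_apply, Pi.single_apply]

theorem xOp_ket (S α : Finset Edge) : xOp S (ket α) = ket (α ∆ S) := by
  ext β
  rw [xOp_apply, ket_apply, ket_apply]
  refine if_congr ?_ rfl rfl
  constructor
  · rintro rfl; rw [symmDiff_symmDiff_cancel_right]
  · rintro rfl; rw [symmDiff_symmDiff_cancel_right]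

theorem diagOp_ket {c : Finset Edge → ℂ} (hc : ∀ α, ‖c α‖ = 1) (α : Finset Edge) :
    diagOp c hc (ket α) = c α • ket α := by
  ext β
  rw [diagOp_apply, lp.coeFn_smul, Pi.smul_apply, ket_apply, smul_eq_mul]
  split_ifs with h
  · rw [h]
  · simp

theorem neg_one_pow_card_symmDiff (S T : Finset Edge) :
    (-1 : ℂ) ^ (S ∆ T).card = (-1) ^ S.card * (-1) ^ T.card := by
  have h1 := Finset.card_sdiff_add_card_inter S T
  have h2 := Finset.card_sdiff_add_card_inter T S
  have h3 : (S ∆ T).card = (S \ T).card + (T \ S).card :=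
    Finset.card_union_of_disjoint disjoint_sdiff_sdiff
  rw [Finset.inter_comm] at h2
  rw [h3, ← h1, ← h2, ← pow_add, show (S \ T).card + (S ∩ T).card + ((T \ S).card + (S ∩ T).card) =
    (S \ T).card + (T \ S).card + 2 * (S ∩ T).card by ring, pow_add _ _ (2 * _), pow_mul]
  simp

theorem xOp_mul_xOp (S T : Finset Edge) : xOp S * xOp T = xOp (S ∆ T) := by
  ext f α
  rw [op_mul_apply, xOp_apply, xOp_apply, xOp_apply, symmDiff_assoc]

theorem zOp_mul_zOp (S T : Finset Edge) : zOp S * zOp T = zOp (S ∆ T) := by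
  ext f α
  rw [op_mul_apply, zOp_apply, zOp_apply, zOp_apply, ← mul_assoc,
    ← neg_one_pow_card_symmDiff]
  congr 3
  exact (inf_symmDiff_distrib_right S T α).symm

theorem zOp_mul_xOp (T S : Finset Edge) :
    zOp T * xOp S = (-1 : ℂ) ^ (T ∩ S).card • (xOp S * zOp T) := by
  ext f α
  rw [op_mul_apply, zOp_apply, xOp_apply, smul_apply,
    op_mul_apply, lp.coeFn_smul, Pi.smul_apply, xOp_apply, zOp_apply,
    smul_eq_mul, ← mul_assoc, ← neg_one_pow_card_symmDiff]
  congr 3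
  have := inf_symmDiff_distrib_left T S (α ∆ S)
  rw [symmDiff_comm α S, symmDiff_symmDiff_cancel_left] at this
  rw [symmDiff_comm α S]
  exact this

theorem xOp_empty : xOp ∅ = 1 := by
  ext f α
  rw [xOp_apply]
  exact congrArg f (symmDiff_bot α)

theorem zOp_empty : zOp ∅ = 1 := by
  ext f α
  rw [zOp_apply]
  simp

theorem sigmaX_eq_xOp (x : Edge) : sigmaX x = xOp {x} := rfl

theorem sigmaZ_eq_zOp (x : Edge) : sigmaZ x = zOp {x} := by
  ext f α
  rw [zOp_apply, sigmaZ, monomialOp_apply]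
  by_cases h : x ∈ α
  · simp [h]
  · simp [h, Finset.singleton_inter_of_notMem]

theorem star_monomialOp_mul_self (e : Equiv.Perm (Finset Edge)) (c : Finset Edge → ℂ)
    (hc : ∀ α, ‖c α‖ = 1) : star (monomialOp e c hc) * monomialOp e c hc = 1 := by
  refine (ContinuousLinearMap.norm_map_iff_adjoint_comp_self _).1 ?_
  intro f
  rw [monomialOp, LinearIsometry.coe_toContinuousLinearMap, LinearIsometry.norm_map]

theorem star_zOp_mul_self (T : Finset Edge) : star (zOp T) * zOp T = 1 := by
  rw [zOp, diagOp, star_monomialOp_mul_self]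

theorem star_eq_self_of_mul_self {u : HilbertSpace →L[ℂ] HilbertSpace} (h : star u * u = 1)
    (h' : u * u = 1) : star u = u := by
  rw [← mul_one (star u), ← h', ← mul_assoc, h, one_mul]

theorem star_sigmaX (x : Edge) : star (sigmaX x) = sigmaX x := by
  refine star_eq_self_of_mul_self (star_monomialOp_mul_self _ _ _) ?_
  rw [sigmaX_eq_xOp, xOp_mul_xOp, symmDiff_self]
  exact xOp_empty

theorem star_sigmaZ (x : Edge) : star (sigmaZ x) = sigmaZ x := by
  refine star_eq_self_of_mul_self (star_monomialOp_mul_self _ _ _) ?_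
  rw [sigmaZ_eq_zOp, zOp_mul_zOp, symmDiff_self]
  exact zOp_empty

/-! ### Local operators -/

theorem sigmaX_mem (x : Edge) : sigmaX x ∈ localAlgebra Set.univ :=
  StarAlgebra.subset_adjoin ℂ _ (Or.inl (Set.mem_image_of_mem _ (Set.mem_univ x)))

theorem sigmaZ_mem (x : Edge) : sigmaZ x ∈ localAlgebra Set.univ :=
  StarAlgebra.subset_adjoin ℂ _ (Or.inr (Set.mem_image_of_mem _ (Set.mem_univ x)))

theorem singleton_symmDiff_of_notMem {S : Finset Edge} {x : Edge} (hx : x ∉ S) :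
    {x} ∆ S = insert x S := by
  ext y
  simp only [Finset.mem_symmDiff, Finset.mem_singleton, Finset.mem_insert]
  grind

theorem xOp_mem (S : Finset Edge) : xOp S ∈ localAlgebra Set.univ := by
  induction S using Finset.induction_on with
  | empty => rw [xOp_empty]; exact one_mem _
  | insert x S hx ih =>
    rw [← singleton_symmDiff_of_notMem hx, ← xOp_mul_xOp]
    exact mul_mem (sigmaX_mem x) ih

theorem zOp_mem (T : Finset Edge) : zOp T ∈ localAlgebra Set.univ := by
  induction T using Finset.induction_on with
  | empty => rw [zOp_empty]; exact one_mem _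
  | insert x S hx ih =>
    rw [← singleton_symmDiff_of_notMem hx, ← zOp_mul_zOp, ← sigmaZ_eq_zOp]
    exact mul_mem (sigmaZ_mem x) ih

/-- The local observables are spanned by the products `xOp S * zOp T`. -/
theorem localAlgebra_le_span (a : HilbertSpace →L[ℂ] HilbertSpace)
    (ha : a ∈ localAlgebra Set.univ) :
    a ∈ Submodule.span ℂ (Set.range fun ST : Finset Edge × Finset Edge =>
      xOp ST.1 * zOp ST.2) := by
  set M := Submodule.span ℂ (Set.range fun ST : Finset Edge × Finset Edge =>
      xOp ST.1 * zOp ST.2) with hM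
  have hmem : ∀ S T, xOp S * zOp T ∈ M := fun S T => Submodule.subset_span ⟨(S, T), rfl⟩
  have hmul : ∀ a ∈ M, ∀ b ∈ M, a * b ∈ M := by
    intro a ha b hb
    induction ha using Submodule.span_induction with
    | zero => rw [zero_mul]; exact zero_mem _
    | add x y _ _ hx hy => rw [add_mul]; exact add_mem hx hy
    | smul c x _ hx => rw [smul_mul_assoc]; exact Submodule.smul_mem _ _ hx
    | mem x hx =>
      obtain ⟨⟨S, T⟩, rfl⟩ := hx
      induction hb using Submodule.span_induction with
      | zero => rw [mul_zero]; exact zero_mem _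
      | add x y _ _ hx hy => rw [mul_add]; exact add_mem hx hy
      | smul c x _ hx => rw [mul_smul_comm]; exact Submodule.smul_mem _ _ hx
      | mem x hx =>
        obtain ⟨⟨S', T'⟩, rfl⟩ := hx
        simp only
        rw [mul_assoc, ← mul_assoc (zOp T), zOp_mul_xOp, smul_mul_assoc, mul_smul_comm, mul_assoc,
          zOp_mul_zOp, ← mul_assoc, xOp_mul_xOp]
        exact Submodule.smul_mem _ _ (hmem _ _)
  have hX : ∀ x, sigmaX x ∈ M := fun x => by
    have := hmem {x} ∅
    rwa [zOp_empty, mul_one] at this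
  have hZ : ∀ x, sigmaZ x ∈ M := fun x => by
    have := hmem ∅ {x}
    rwa [xOp_empty, one_mul, ← sigmaZ_eq_zOp] at this
  have h1 : (1 : HilbertSpace →L[ℂ] HilbertSpace) ∈ M := by
    have := hmem ∅ ∅
    rwa [xOp_empty, zOp_empty, one_mul] at this
  change a ∈ Algebra.adjoin ℂ _ at ha
  induction ha using Algebra.adjoin_induction with
  | mem x hx =>
    rcases hx with (⟨y, -, rfl⟩ | ⟨y, -, rfl⟩) | (⟨y, -, hy⟩ | ⟨y, -, hy⟩)
    · exact hX y
    · exact hZ y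
    · rw [← star_star x, ← hy, star_sigmaX]; exact hX y
    · rw [← star_star x, ← hy, star_sigmaZ]; exact hZ y
  | algebraMap r => rw [Algebra.algebraMap_eq_smul_one]; exact Submodule.smul_mem _ _ h1
  | add x y _ _ hx hy => exact add_mem hx hy
  | mul x y _ _ hx hy => exact hmul x hx y hy

/-- The span of the operators `zOp T`. -/
def zSpan : Submodule ℂ (HilbertSpace →L[ℂ] HilbertSpace) := Submodule.span ℂ (Set.range zOp)

theorem zOp_mem_zSpan (T : Finset Edge) : zOp T ∈ zSpan := Submodule.subset_span ⟨T, rfl⟩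

theorem mul_mem_zSpan {a b : HilbertSpace →L[ℂ] HilbertSpace} (ha : a ∈ zSpan) (hb : b ∈ zSpan) :
    a * b ∈ zSpan := by
  induction ha using Submodule.span_induction with
  | zero => rw [zero_mul]; exact zero_mem _
  | add x y _ _ hx hy => rw [add_mul]; exact add_mem hx hy
  | smul c x _ hx => rw [smul_mul_assoc]; exact Submodule.smul_mem _ _ hx
  | mem x hx =>
    obtain ⟨T, rfl⟩ := hx
    induction hb using Submodule.span_induction with
    | zero => rw [mul_zero]; exact zero_mem _
    | add x y _ _ hx hy => rw [mul_add]; exact add_mem hx hy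
    | smul c x _ hx => rw [mul_smul_comm]; exact Submodule.smul_mem _ _ hx
    | mem x hx =>
      obtain ⟨T', rfl⟩ := hx
      rw [zOp_mul_zOp]
      exact zOp_mem_zSpan _

theorem zSpan_le_localAlgebra {a : HilbertSpace →L[ℂ] HilbertSpace} (ha : a ∈ zSpan) :
    a ∈ localAlgebra Set.univ := by
  induction ha using Submodule.span_induction with
  | zero => exact zero_mem _
  | add x y _ _ hx hy => exact add_mem hx hy
  | smul c x _ hx => exact (localAlgebra Set.univ).toSubalgebra.smul_mem hx c
  | mem x hx =>
    obtain ⟨T, rfl⟩ := hx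
    exact zOp_mem T

/-- Diagonal operators move past `xOp S`, up to a change of the diagonal operator. -/
theorem exists_mul_xOp_eq {a : HilbertSpace →L[ℂ] HilbertSpace} (ha : a ∈ zSpan)
    (S : Finset Edge) : ∃ b ∈ zSpan, xOp S * a = b * xOp S := by
  induction ha using Submodule.span_induction with
  | zero => exact ⟨0, zero_mem _, by rw [mul_zero, zero_mul]⟩
  | add x y _ _ hx hy =>
    obtain ⟨b, hb, h⟩ := hx
    obtain ⟨b', hb', h'⟩ := hy
    exact ⟨b + b', add_mem hb hb', by rw [mul_add, add_mul, h, h']⟩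
  | smul c x _ hx =>
    obtain ⟨b, hb, h⟩ := hx
    exact ⟨c • b, Submodule.smul_mem _ _ hb, by rw [mul_smul_comm, smul_mul_assoc, h]⟩
  | mem x hx =>
    obtain ⟨T, rfl⟩ := hx
    refine ⟨_, Submodule.smul_mem _ ((-1 : ℂ) ^ (T ∩ S).card) (zOp_mem_zSpan T), ?_⟩
    rw [smul_mul_assoc, zOp_mul_xOp, smul_smul, ← mul_pow]
    simp

theorem norm_legPhase (p : Hexagon) (α : Finset Edge) : ‖legPhase p α‖ = 1 := by
  rw [legPhase, norm_neg, norm_prod]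
  refine Finset.prod_eq_one fun k _ => ?_
  split_ifs <;> simp

/-- The diagonal operator with entries `legPhase p`. -/
def legOp (p : Hexagon) : HilbertSpace →L[ℂ] HilbertSpace := diagOp (legPhase p) (norm_legPhase p)

theorem diagOp_prod_mem_zSpan {ι : Type*} [DecidableEq ι] (l : ι → Edge) (K : Finset ι)
    (hc : ∀ α : Finset Edge, ‖∏ k ∈ K, (if l k ∈ α then Complex.I else 1)‖ = 1) :
    diagOp (fun α => ∏ k ∈ K, (if l k ∈ α then Complex.I else 1)) hc ∈ zSpan := by
  induction K using Finset.induction_on with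
  | empty =>
    convert zOp_mem_zSpan ∅
    rw [zOp_empty]
    ext f α
    rw [diagOp_apply]
    simp
  | insert k K hk ih =>
    have hc' : ∀ α : Finset Edge, ‖∏ k ∈ K, (if l k ∈ α then Complex.I else 1)‖ = 1 := by
      intro α
      rw [norm_prod]
      refine Finset.prod_eq_one fun k _ => ?_
      split_ifs <;> simp
    -- The diagonal matrix with entries `1`, `I` is `(1 + I) / 2 + (1 - I) / 2 * σᶻ`.
    have h1 : ((1 + Complex.I) / 2) • (1 : HilbertSpace →L[ℂ] HilbertSpace) +
        ((1 - Complex.I) / 2) • zOp {l k} ∈ zSpan := by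
      rw [← zOp_empty]
      exact add_mem (Submodule.smul_mem _ _ (zOp_mem_zSpan _))
        (Submodule.smul_mem _ _ (zOp_mem_zSpan _))
    convert mul_mem_zSpan h1 (ih hc') using 1
    ext f α
    rw [diagOp_apply, op_mul_apply, add_apply,
      smul_apply, smul_apply, lp.coeFn_add, Pi.add_apply,
      lp.coeFn_smul, lp.coeFn_smul, Pi.smul_apply, Pi.smul_apply, zOp_apply,
      one_apply_eq_self, diagOp_apply, Finset.prod_insert hk]
    by_cases h : l k ∈ α
    · simp only [h, if_true, Finset.singleton_inter_of_mem, Finset.card_singleton, smul_eq_mul]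
      ring
    · simp only [h, if_false, Finset.singleton_inter_of_notMem h, Finset.card_empty, smul_eq_mul]
      ring

theorem legOp_mem_zSpan (p : Hexagon) : legOp p ∈ zSpan := by
  have hc : ∀ α : Finset Edge,
      ‖∏ k ∈ Finset.univ, (if leg p k ∈ α then Complex.I else 1)‖ = 1 := by
    intro α
    have := norm_legPhase p α
    rwa [legPhase, norm_neg] at this
  have := neg_mem (diagOp_prod_mem_zSpan (leg p) Finset.univ hc)
  convert this using 1
  ext f α
  rw [legOp, diagOp_apply, legPhase, neg_apply, lp.coeFn_neg, Pi.neg_apply,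
    diagOp_apply, neg_mul]

theorem legPhase_pow_four (p : Hexagon) (α : Finset Edge) : legPhase p α ^ 4 = 1 := by
  rw [legPhase, Even.neg_pow (by decide), ← Finset.prod_pow]
  refine Finset.prod_eq_one fun k _ => ?_
  split_ifs <;> simp

theorem legOp_pow_four (p : Hexagon) : legOp p ^ 4 = 1 := by
  ext f α
  have h : legOp p ^ 4 = legOp p * (legOp p * (legOp p * legOp p)) := by
    simp only [pow_succ, pow_zero, one_mul, mul_assoc]
  rw [h]
  simp only [op_mul_apply, legOp, diagOp_apply,
    one_apply_eq_self]
  rw [← mul_assoc, ← mul_assoc, ← mul_assoc]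
  convert one_mul (f α) using 2
  rw [← legPhase_pow_four p α]
  ring

/-- The plaquette operator of the double semion model at the hexagon `p`: it adds or removes `p`
and multiplies with the phase given by the legs of `p`. -/
def plaquetteOp (p : Hexagon) : HilbertSpace →L[ℂ] HilbertSpace := legOp p * xOp p.edges

theorem plaquetteOp_mem (p : Hexagon) : plaquetteOp p ∈ localAlgebra Set.univ :=
  mul_mem (zSpan_le_localAlgebra (legOp_mem_zSpan p)) (xOp_mem _)

theorem star_plaquetteOp_mul_self (p : Hexagon) : star (plaquetteOp p) * plaquetteOp p = 1 := by
  rw [plaquetteOp, star_mul, mul_assoc, ← mul_assoc (star (legOp p)), legOp, diagOp,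
    star_monomialOp_mul_self, one_mul, xOp, star_monomialOp_mul_self]

/-- Here `legOp p ^ 3` is the inverse of `legOp p`. -/
theorem xOp_edges_eq (p : Hexagon) : xOp p.edges = legOp p ^ 3 * plaquetteOp p := by
  rw [plaquetteOp, ← mul_assoc, ← pow_succ, legOp_pow_four, one_mul]

theorem zOp_mul_plaquetteOp (T : Finset Edge) (p : Hexagon) :
    zOp T * plaquetteOp p = (-1 : ℂ) ^ (T ∩ p.edges).card • (plaquetteOp p * zOp T) := by
  have h : zOp T * legOp p = legOp p * zOp T := by
    ext f α
    simp only [op_mul_apply, legOp, diagOp_apply, zOp_apply]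
    ring
  rw [plaquetteOp, ← mul_assoc, h, mul_assoc, zOp_mul_xOp, mul_smul_comm, mul_assoc]

/-! ### The double semion vectors -/

theorem hexagonOp_eq_xOp (p : Hexagon) : hexagonOp p = xOp p.edges := by
  have : ∀ (S : Finset Edge) (hS), S.noncommProd sigmaX hS = xOp S := by
    intro S
    induction S using Finset.induction_on with
    | empty => intro hS; rw [Finset.noncommProd_empty, xOp_empty]
    | insert x S hx ih =>
      intro hS
      rw [Finset.noncommProd_insert_of_notMem _ _ _ _ hx, ih, sigmaX_eq_xOp, xOp_mul_xOp,
        singleton_symmDiff_of_notMem hx]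
  exact this _ _

theorem regionOp_eq_xOp (P : Finset Hexagon) : regionOp P = xOp (boundary P) := by
  have : ∀ (P : Finset Hexagon) (hP), P.noncommProd hexagonOp hP = xOp (boundary P) := by
    intro P
    induction P using Finset.induction_on with
    | empty => intro hP; rw [Finset.noncommProd_empty, boundary_empty, xOp_empty]
    | insert p P hp ih =>
      intro hP
      rw [Finset.noncommProd_insert_of_notMem _ _ _ _ hp, ih, hexagonOp_eq_xOp, xOp_mul_xOp,
        boundary_insert hp, symmDiff_comm]
  exact this _ _

theorem regionOp_vacuum (P : Finset Hexagon) : regionOp P vacuum = ket (boundary P) := by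
  rw [regionOp_eq_xOp]
  refine (xOp_ket (boundary P) ∅).trans ?_
  exact congrArg ket (bot_symmDiff _)

theorem plaquetteOp_ket_boundary (p : Hexagon) (P : Finset Hexagon) :
    plaquetteOp p (ket (boundary P)) =
      legPhase p (boundary P) • ket (boundary (P ∆ {p})) := by
  rw [plaquetteOp, op_mul_apply, xOp_ket, legOp, diagOp_ket,
    legPhase_symmDiff_edges, boundary_symmDiff_singleton]

/-- The plaquette operator at `p` permutes the terms of the double semion vector. -/
theorem plaquetteOp_semionVector {L : Finset Hexagon} {p : Hexagon} (hp : p ∈ L) :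
    plaquetteOp p (semionVector L) = semionVector L := by
  simp only [semionVector, regionOp_vacuum, map_smul, map_sum, plaquetteOp_ket_boundary]
  congr 1
  have hmem : ∀ P ∈ L.powerset, P ∆ {p} ∈ L.powerset := by
    intro P hP
    rw [Finset.mem_powerset] at hP ⊢
    intro q hq
    rw [Finset.mem_symmDiff, Finset.mem_singleton] at hq
    rcases hq with h | h
    · exact hP h.1
    · exact h.1 ▸ hp
  refine Finset.sum_nbij' (· ∆ {p}) (· ∆ {p}) hmem hmem
    (fun P _ => symmDiff_symmDiff_cancel_right _ _)
    (fun P _ => symmDiff_symmDiff_cancel_right _ _) fun P _ => ?_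
  rw [neg_one_pow_loopCount_symmDiff_singleton, smul_smul]

theorem zOp_vertexStar_semionVector (L : Finset Hexagon) (v : Vertex) :
    zOp (vertexStar v) (semionVector L) = semionVector L := by
  simp only [semionVector, regionOp_vacuum, map_smul, map_sum]
  congr 1
  refine Finset.sum_congr rfl fun P _ => ?_
  congr 1
  rw [zOp, diagOp_ket, Finset.inter_comm, (even_card_boundary_inter_star P v).neg_one_pow, one_smul]

theorem orthonormal_ket_boundary : Orthonormal ℂ fun P : Finset Hexagon => ket (boundary P) := by
  rw [orthonormal_iff_ite]
  intro P Q
  rw [ket, lp.inner_single_left]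
  change inner ℂ (1 : ℂ) (ket (boundary Q) (boundary P)) = _
  rw [ket_apply]
  simp only [boundary_injective.eq_iff]
  split_ifs <;> simp

theorem inner_semionVector_self (L : Finset Hexagon) :
    inner ℂ (semionVector L) (semionVector L) = 1 := by
  simp only [semionVector, regionOp_vacuum]
  rw [inner_smul_left, inner_smul_right, orthonormal_ket_boundary.inner_sum]
  have h : ∀ P : Finset Hexagon,
      (starRingEnd ℂ) ((-1 : ℂ) ^ loopCount P) * (-1) ^ loopCount P = 1 := by
    intro P
    rw [map_pow, ← mul_pow]
    simp
  rw [Finset.sum_congr rfl fun P _ => h P, Finset.sum_const, Finset.card_powerset, nsmul_eq_mul,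
    mul_one, Complex.conj_ofReal, ← mul_assoc, ← Complex.ofReal_mul,
    Real.mul_self_sqrt (by positivity)]
  push_cast
  exact one_div_mul_cancel (by positivity)

/-! ### States fixed by a unitary -/

theorem eq_zero_of_forall_nonneg_add_mul {c z : ℂ} (h : ∀ s : ℝ, 0 ≤ c + s * z) : z = 0 := by
  have him : ∀ s : ℝ, c.im + s * z.im = 0 := fun s => by
    have := (Complex.nonneg_iff.1 (h s)).2
    simpa using this.symm
  have hre : ∀ s : ℝ, 0 ≤ c.re + s * z.re := fun s => by
    have := (Complex.nonneg_iff.1 (h s)).1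
    simpa using this
  refine Complex.ext ?_ ?_
  · by_contra hz
    rw [Complex.zero_re] at hz
    have := hre (-(c.re + 1) / z.re)
    rw [div_mul_cancel₀ _ hz] at this
    linarith
  · have h0 := him 0
    have h1 := him 1
    rw [Complex.zero_im]
    linarith

section State

variable {A : Type*} [CStarAlgebra A] {φ : WeakDual ℂ A}

/-- A consequence of the Cauchy–Schwarz inequality for states. -/
theorem apply_star_mul_eq_zero (hφ : φ ∈ stateSpace A) {b : A} (hb : φ (star b * b) = 0) (a : A) :
    φ (star a * b) = 0 ∧ φ (star b * a) = 0 := by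
  have key : ∀ t : ℂ, 0 ≤ φ (star a * a) +
      (t * φ (star a * b) + (starRingEnd ℂ) t * φ (star b * a)) := by
    intro t
    have h := hφ.1 (a + t • b)
    have e : star (a + t • b) * (a + t • b) = star a * a + (t • (star a * b) +
        (starRingEnd ℂ) t • (star b * a)) + ((starRingEnd ℂ) t * t) • (star b * b) := by
      rw [star_add, star_smul, add_mul, mul_add, mul_add, smul_mul_assoc, smul_mul_assoc,
        mul_smul_comm, mul_smul_comm, smul_smul]
      change _ = star a * a + (t • (star a * b) + star t • (star b * a)) +
        (star t * t) • (star b * b)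
      abel
    rw [e, map_add, map_add, map_add, map_smul, map_smul, map_smul, hb, smul_zero, add_zero,
      smul_eq_mul, smul_eq_mul] at h
    exact h
  have h1 : φ (star a * b) + φ (star b * a) = 0 := by
    refine eq_zero_of_forall_nonneg_add_mul (c := φ (star a * a)) fun s => ?_
    have := key s
    rwa [Complex.conj_ofReal, ← mul_add] at this
  have h2 : Complex.I * (φ (star a * b) - φ (star b * a)) = 0 := by
    refine eq_zero_of_forall_nonneg_add_mul (c := φ (star a * a)) fun s => ?_
    have := key (s * Complex.I)
    rw [map_mul (starRingEnd ℂ), Complex.conj_ofReal, Complex.conj_I] at this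
    convert this using 2
    ring
  have h3 := (mul_eq_zero.1 h2).resolve_left Complex.I_ne_zero
  constructor
  · linear_combination h1 / 2 + h3 / 2
  · linear_combination h1 / 2 - h3 / 2

theorem apply_mul_of_fixes (hφ : φ ∈ stateSpace A) {u : A}
    (hu : φ (star (u - 1) * (u - 1)) = 0) (a : A) : φ (a * u) = φ a := by
  have := (apply_star_mul_eq_zero hφ hu (star a)).1
  rwa [star_star, mul_sub, mul_one, map_sub, sub_eq_zero] at this

theorem apply_star_mul_of_fixes (hφ : φ ∈ stateSpace A) {u : A}
    (hu : φ (star (u - 1) * (u - 1)) = 0) (a : A) : φ (star u * a) = φ a := by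
  have := (apply_star_mul_eq_zero hφ hu a).2
  rwa [star_sub, star_one, sub_mul, one_mul, map_sub, sub_eq_zero] at this

/-- A state fixed by an isometry vanishes on the elements that anticommute with it. -/
theorem apply_eq_zero_of_anticommute (hφ : φ ∈ stateSpace A) {u : A} (hs : star u * u = 1)
    (hu : φ (star (u - 1) * (u - 1)) = 0) {a : A} (ha : a * u = -(u * a)) : φ a = 0 := by
  have h1 := apply_star_mul_of_fixes hφ hu (a * u)
  rw [ha, mul_neg, ← mul_assoc, hs, one_mul, map_neg, ← ha, apply_mul_of_fixes hφ hu] at h1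
  exact self_eq_neg.1 h1.symm

theorem isClosed_stateSpace : IsClosed (stateSpace A) := by
  have h : stateSpace A = (⋂ a : A, {φ : WeakDual ℂ A | 0 ≤ φ (star a * a)}) ∩
      {φ : WeakDual ℂ A | φ 1 = 1} := by
    ext φ
    simp [stateSpace]
  rw [h]
  exact (isClosed_iInter fun a => isClosed_Ici.preimage (WeakDual.eval_continuous _)).inter
    (isClosed_singleton.preimage (WeakDual.eval_continuous (1 : A)))

end State

/-! ### The stabilizers as elements of the quasi-local algebra -/

theorem mem_quasiLocalAlgebra {a : HilbertSpace →L[ℂ] HilbertSpace}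
    (ha : a ∈ localAlgebra Set.univ) : a ∈ quasiLocalAlgebra :=
  StarSubalgebra.le_topologicalClosure _ ha

/-- `xOp S` in the quasi-local algebra. -/
def xElem (S : Finset Edge) : quasiLocalAlgebra := ⟨xOp S, mem_quasiLocalAlgebra (xOp_mem S)⟩

/-- `zOp T` in the quasi-local algebra. -/
def zElem (T : Finset Edge) : quasiLocalAlgebra := ⟨zOp T, mem_quasiLocalAlgebra (zOp_mem T)⟩

/-- `plaquetteOp p` in the quasi-local algebra. -/
def plaquette (p : Hexagon) : quasiLocalAlgebra :=
  ⟨plaquetteOp p, mem_quasiLocalAlgebra (plaquetteOp_mem p)⟩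

/-- The states that are fixed by all vertex operators and all plaquette operators, that is, the
frustration-free ground states of the double semion model. -/
def groundStates : Set (WeakDual ℂ quasiLocalAlgebra) :=
  {φ | φ ∈ stateSpace quasiLocalAlgebra ∧
    (∀ v, φ (star (zElem (vertexStar v) - 1) * (zElem (vertexStar v) - 1)) = 0) ∧
    ∀ p, φ (star (plaquette p - 1) * (plaquette p - 1)) = 0}

theorem star_plaquette_mul_self (p : Hexagon) : star (plaquette p) * plaquette p = 1 :=
  Subtype.ext (star_plaquetteOp_mul_self p)

theorem star_zElem_mul_self (T : Finset Edge) : star (zElem T) * zElem T = 1 :=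
  Subtype.ext (star_zOp_mul_self T)

/-- On products of `σᶻ`, a ground state takes the values zero and one. -/
theorem apply_zElem {φ : WeakDual ℂ quasiLocalAlgebra} (hφ : φ ∈ groundStates) (T : Finset Edge) :
    φ (zElem T) = open scoped Classical in
      if ∀ p : Hexagon, Even (T ∩ p.edges).card then 1 else 0 := by
  obtain ⟨hs, hv, hp⟩ := hφ
  split_ifs with h
  · refine star_induction (C := fun T => φ (zElem T) = 1) ?_ (fun T v hT => ?_) h
    · rw [show zElem ∅ = 1 from Subtype.ext zOp_empty]
      exact hs.2
    · rw [show zElem (T ∆ vertexStar v) = zElem T * zElem (vertexStar v) from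
        Subtype.ext (zOp_mul_zOp _ _).symm, apply_mul_of_fixes hs (hv v), hT]
  · rw [not_forall] at h
    obtain ⟨p, h⟩ := h
    refine apply_eq_zero_of_anticommute hs (star_plaquette_mul_self p) (hp p) (Subtype.ext ?_)
    change zOp T * plaquetteOp p = -(plaquetteOp p * zOp T)
    rw [zOp_mul_plaquetteOp, (Nat.not_even_iff_odd.1 h).neg_one_pow, neg_one_smul]

theorem eq_of_mem_span {φ ψ : WeakDual ℂ quasiLocalAlgebra} {ι : Type*}
    (f : ι → quasiLocalAlgebra) (hf : ∀ i, φ (f i) = ψ (f i)) (a : quasiLocalAlgebra)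
    (ha : (a : HilbertSpace →L[ℂ] HilbertSpace) ∈
      Submodule.span ℂ (Set.range fun i => (f i : HilbertSpace →L[ℂ] HilbertSpace))) :
    φ a = ψ a := by
  have h1 : (Set.range fun i => (f i : HilbertSpace →L[ℂ] HilbertSpace)) =
      quasiLocalAlgebra.toSubalgebra.val.toLinearMap '' Set.range f := by
    rw [← Set.range_comp]
    rfl
  rw [h1, Submodule.span_image] at ha
  obtain ⟨b, hb, hba⟩ := ha
  have : b = a := Subtype.ext hba
  subst this
  clear hba
  induction hb using Submodule.span_induction with
  | zero => rw [map_zero, map_zero]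
  | add x y _ _ hx hy => rw [map_add, map_add, hx, hy]
  | smul c x _ hx => rw [map_smul, map_smul, hx]
  | mem x hx =>
    obtain ⟨i, rfl⟩ := hx
    exact hf i

/-- Two ground states agree on the products of a region operator and a diagonal operator: the
region operator can be traded for diagonal operators, one hexagon at a time. -/
theorem apply_xElem_boundary_mul_zElem {φ ψ : WeakDual ℂ quasiLocalAlgebra}
    (hφ : φ ∈ groundStates) (hψ : ψ ∈ groundStates) (Q : Finset Hexagon) (T : Finset Edge) :
    φ (xElem (boundary Q) * zElem T) = ψ (xElem (boundary Q) * zElem T) := by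
  induction Q using Finset.induction_on generalizing T with
  | empty =>
    rw [boundary_empty, show xElem ∅ = 1 from Subtype.ext xOp_empty, one_mul, apply_zElem hφ,
      apply_zElem hψ]
  | insert p Q hp ih =>
    obtain ⟨b, hb, hbT⟩ := exists_mul_xOp_eq (zOp_mem_zSpan T) p.edges
    have hd : b * legOp p ^ 3 ∈ zSpan := by
      have h := legOp_mem_zSpan p
      rw [pow_succ, pow_two]
      exact mul_mem_zSpan hb (mul_mem_zSpan (mul_mem_zSpan h h) h)
    let c : quasiLocalAlgebra := ⟨xOp (boundary Q) * (b * legOp p ^ 3),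
      mem_quasiLocalAlgebra (mul_mem (xOp_mem _) (zSpan_le_localAlgebra hd))⟩
    have hc : xElem (boundary (insert p Q)) * zElem T = c * plaquette p := by
      refine Subtype.ext ?_
      change xOp (boundary (insert p Q)) * zOp T =
        xOp (boundary Q) * (b * legOp p ^ 3) * plaquetteOp p
      rw [boundary_insert hp, ← xOp_mul_xOp, mul_assoc, hbT, mul_assoc, mul_assoc, ← xOp_edges_eq]
    rw [hc, apply_mul_of_fixes hφ.1 (hφ.2.2 p), apply_mul_of_fixes hψ.1 (hψ.2.2 p)]
    refine eq_of_mem_span (fun T => xElem (boundary Q) * zElem T) ih c ?_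
    have h := Submodule.mem_map_of_mem (f := LinearMap.mulLeft ℂ (xOp (boundary Q))) hd
    rw [zSpan, Submodule.map_span, ← Set.range_comp] at h
    exact h

theorem apply_xElem_mul_zElem {φ ψ : WeakDual ℂ quasiLocalAlgebra}
    (hφ : φ ∈ groundStates) (hψ : ψ ∈ groundStates) (S T : Finset Edge) :
    φ (xElem S * zElem T) = ψ (xElem S * zElem T) := by
  by_cases h : ∀ v, Even (S ∩ vertexStar v).card
  · obtain ⟨Q, rfl⟩ := exists_eq_boundary h
    exact apply_xElem_boundary_mul_zElem hφ hψ Q T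
  · rw [not_forall] at h
    obtain ⟨v, h⟩ := h
    have ha : xElem S * zElem T * zElem (vertexStar v) =
        -(zElem (vertexStar v) * (xElem S * zElem T)) := by
      refine Subtype.ext ?_
      change xOp S * zOp T * zOp (vertexStar v) = -(zOp (vertexStar v) * (xOp S * zOp T))
      rw [← mul_assoc, zOp_mul_xOp, Finset.inter_comm, (Nat.not_even_iff_odd.1 h).neg_one_pow,
        neg_one_smul, neg_mul, neg_neg, mul_assoc, mul_assoc, zOp_mul_zOp, zOp_mul_zOp,
        symmDiff_comm]
    rw [apply_eq_zero_of_anticommute hφ.1 (star_zElem_mul_self _) (hφ.2.1 v) ha,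
      apply_eq_zero_of_anticommute hψ.1 (star_zElem_mul_self _) (hψ.2.1 v) ha]

/-- The double semion model on the plane has at most one frustration-free ground state. -/
theorem groundStates_subsingleton : groundStates.Subsingleton := by
  intro φ hφ ψ hψ
  have hdense : Dense {a : quasiLocalAlgebra |
      (a : HilbertSpace →L[ℂ] HilbertSpace) ∈ localAlgebra Set.univ} := by
    intro a
    rw [closure_subtype]
    have ha : (a : HilbertSpace →L[ℂ] HilbertSpace) ∈
        closure (localAlgebra Set.univ : Set (HilbertSpace →L[ℂ] HilbertSpace)) := a.2
    refine closure_mono ?_ ha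
    intro b hb
    exact ⟨⟨b, mem_quasiLocalAlgebra hb⟩, hb, rfl⟩
  refine DFunLike.ext' (Continuous.ext_on hdense (map_continuous φ) (map_continuous ψ) ?_)
  intro a ha
  exact eq_of_mem_span (fun ST : Finset Edge × Finset Edge => xElem ST.1 * zElem ST.2)
    (fun ST => apply_xElem_mul_zElem hφ hψ ST.1 ST.2) a (localAlgebra_le_span _ ha)

/-! ### The double semion states -/

theorem vectorFunctional_star_mul_self (Ψ : HilbertSpace) (a : quasiLocalAlgebra) :
    vectorFunctional Ψ (star a * a) =
      inner ℂ ((a : HilbertSpace →L[ℂ] HilbertSpace) Ψ)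
        ((a : HilbertSpace →L[ℂ] HilbertSpace) Ψ) := by
  change inner ℂ Ψ (ContinuousLinearMap.adjoint (a : HilbertSpace →L[ℂ] HilbertSpace)
    ((a : HilbertSpace →L[ℂ] HilbertSpace) Ψ)) = _
  rw [ContinuousLinearMap.adjoint_inner_right]

theorem vectorFunctional_fixes {Ψ : HilbertSpace} {u : quasiLocalAlgebra}
    (hu : (u : HilbertSpace →L[ℂ] HilbertSpace) Ψ = Ψ) :
    vectorFunctional Ψ (star (u - 1) * (u - 1)) = 0 := by
  rw [vectorFunctional_star_mul_self]
  have : ((u - 1 : quasiLocalAlgebra) : HilbertSpace →L[ℂ] HilbertSpace) Ψ = 0 := by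
    change (u : HilbertSpace →L[ℂ] HilbertSpace) Ψ - Ψ = 0
    rw [hu, sub_self]
  rw [this, inner_zero_left]

theorem semionState_mem_stateSpace (L : Finset Hexagon) :
    semionState L ∈ stateSpace quasiLocalAlgebra := by
  refine ⟨fun a => ?_, inner_semionVector_self L⟩
  rw [semionState, vectorFunctional_star_mul_self, inner_self_eq_norm_sq_to_K]
  change (0 : ℂ) ≤
    ((‖(a : HilbertSpace →L[ℂ] HilbertSpace) (semionVector L)‖ : ℝ) : ℂ) ^ 2
  rw [← Complex.ofReal_pow]
  exact Complex.zero_le_real.2 (sq_nonneg _)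

theorem norm_semionVector (L : Finset Hexagon) : ‖semionVector L‖ = 1 := by
  rw [norm_eq_sqrt_re_inner (𝕜 := ℂ), inner_semionVector_self, RCLike.one_re, Real.sqrt_one]

theorem semionState_mem_closedBall (L : Finset Hexagon) : semionState L ∈
    WeakDual.toStrongDual ⁻¹' Metric.closedBall (0 : StrongDual ℂ quasiLocalAlgebra) 1 := by
  rw [Set.mem_preimage, mem_closedBall_zero_iff]
  refine ContinuousLinearMap.opNorm_le_bound _ zero_le_one fun a => ?_
  change ‖inner ℂ (semionVector L) ((a : HilbertSpace →L[ℂ] HilbertSpace) (semionVector L))‖ ≤ _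
  refine (norm_inner_le_norm _ _).trans ?_
  have h := (a : HilbertSpace →L[ℂ] HilbertSpace).le_opNorm (semionVector L)
  rw [norm_semionVector, mul_one] at h
  rw [norm_semionVector, one_mul, one_mul]
  exact h

/-- The finite-volume states accumulate, as the volume grows, at ground states only. -/
theorem mem_groundStates_of_clusterPt {ω : WeakDual ℂ quasiLocalAlgebra}
    (h : ClusterPt ω (map semionState atTop)) : ω ∈ groundStates := by
  have hclosed : ∀ s : Set (WeakDual ℂ quasiLocalAlgebra), IsClosed s →
      (∀ᶠ L in atTop, semionState L ∈ s) → ω ∈ s := fun s hs hev =>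
    hs.closure_eq ▸ (h.mono (le_principal_iff.2 hev)).mem_closure
  have heval : ∀ a : quasiLocalAlgebra,
      IsClosed {φ : WeakDual ℂ quasiLocalAlgebra | φ a = 0} := fun a =>
    isClosed_singleton.preimage (WeakDual.eval_continuous a)
  refine ⟨hclosed _ isClosed_stateSpace (Eventually.of_forall semionState_mem_stateSpace),
    fun v => hclosed _ (heval _) (Eventually.of_forall fun L => ?_),
    fun p => hclosed _ (heval _) ?_⟩
  · exact vectorFunctional_fixes (zOp_vertexStar_semionVector L v)
  · filter_upwards [eventually_ge_atTop {p}] with L hL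
    exact vectorFunctional_fixes (plaquetteOp_semionVector (hL (Finset.mem_singleton_self p)))

theorem exists_tendsto_semionState :
    ∃ ω ∈ groundStates, Tendsto semionState atTop (𝓝 ω) := by
  have hK := WeakDual.isCompact_closedBall (𝕜 := ℂ) (0 : StrongDual ℂ quasiLocalAlgebra) 1
  have hmem : ∀ᶠ L in atTop, semionState L ∈
      WeakDual.toStrongDual ⁻¹' Metric.closedBall (0 : StrongDual ℂ quasiLocalAlgebra) 1 :=
    Eventually.of_forall semionState_mem_closedBall
  obtain ⟨ω, -, hω⟩ := hK (f := map semionState atTop) (le_principal_iff.2 hmem)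
  have hg := mem_groundStates_of_clusterPt hω
  refine ⟨ω, hg, hK.le_nhds_of_unique_clusterPt hmem fun ψ _ hψ => ?_⟩
  exact groundStates_subsingleton (mem_groundStates_of_clusterPt hψ) hg

/-- The ground states form a face of the state space, because each of their defining equations says
that a positive element has expectation zero. -/
theorem groundStates_subset_pureStates : groundStates ⊆ pureStates quasiLocalAlgebra := by
  intro ω hω
  refine mem_extremePoints_iff_left.2 ⟨hω.1, fun φ hφ ψ hψ hmem => ?_⟩
  obtain ⟨s, t, hs, ht, -, hst⟩ := hmem
  have hface : ∀ b : quasiLocalAlgebra, ω (star b * b) = 0 → φ (star b * b) = 0 := by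
    intro b hb
    have h1 : (s : ℂ) * φ (star b * b) + (t : ℂ) * ψ (star b * b) = 0 := by
      rw [← hb, ← hst]
      rfl
    have h2 : 0 ≤ (t : ℂ) * ψ (star b * b) :=
      mul_nonneg (by exact_mod_cast ht.le) (hψ.1 b)
    have h3 : 0 ≤ (s : ℂ) * φ (star b * b) :=
      mul_nonneg (by exact_mod_cast hs.le) (hφ.1 b)
    have h4 := ((add_eq_zero_iff_of_nonneg h3 h2).1 h1).1
    exact (mul_eq_zero.1 h4).resolve_left (by exact_mod_cast hs.ne')
  refine groundStates_subsingleton ⟨hφ, fun v => hface _ (hω.2.1 v), fun p => hface _ (hω.2.2 p)⟩ hω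

end DoubleSemion

end

theorem mainTheorem1 :
    ∃ ω ∈ DoubleSemion.pureStates DoubleSemion.quasiLocalAlgebra,
      ∀ L : ℕ → Finset DoubleSemion.Hexagon, Monotone L → (∀ p, ∃ n, p ∈ L n) →
        Filter.Tendsto (fun n => DoubleSemion.semionState (L n)) Filter.atTop (nhds ω) := by
  obtain ⟨ω, hω, hlim⟩ := DoubleSemion.exists_tendsto_semionState
  exact ⟨ω, DoubleSemion.groundStates_subset_pureStates hω, fun L hL hex =>
    hlim.comp (tendsto_atTop_finset_of_monotone hL hex)⟩
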